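/- **Setting.** Let $(K,v)$ be a valued field with value group $\Gamma=vK$ (written additively). Let $I_\Gamma$ be the set of non-zero principal convex subgroups of $\Gamma$, ordered by decreasing inclusion, and let $\mathbb I=I_\Gamma\sqcup\{i_S\mid S \text{ an initial segment of } I_\Gamma\}$, where $i<i_S$ for $i\in S$, $i_S<j$ for $j\in I_\Gamma\setminus S$, and $i_S<i_T$ iff $S\subsetneq T$. Fix an ordered embedding of $\Gamma$ in the Hahn product $\mathbb R^{I_\Gamma}_{\rm lex}\subset\mathbb R^{\mathbb I}_{\rm lex}$, let $\Gamma_{\mathbb Q}\subset \mathbb R^{\mathbb I}_{\rm lex}$ be the divisible closure of $\Gamma$, and let $\Lambda=\mathbb R_{\rm sme}=\bigcup_S\mathbb R^{I_\Gamma\sqcup\{i_S\}}_{\rm lex}\subset\mathbb R^{\mathbb I}_{\rm lex}$ and $\Lambda_\infty=\Lambda\cup\{\infty\}$. Let $\mathcal V$ be the set of valuations $K[x]\to\Lambda_\infty$ extending $v$, ordered pointwise. Two members $\mu,\mu'$ of $\mathcal V$ are *equivalent* if there is an isomorphism of ordered groups $\tau$ between their value groups with $\tau\circ\mu=\mu'$.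 We say that $\mu\in\mathcal V$ is *a supremum up to equivalence* of a family $(\nu_i)$ in $\mathcal V$ if $\nu_i\le\mu$ for all $i$ and, for every $\mu'\in\mathcal V$ with $\nu_i\le\mu'$ for all $i$, there is $\mu''\in\mathcal V$ equivalent to $\mu$ with $\mu''\le\mu'$. Let $\underline a=\{a_i\}_{i\in I}$ be a pseudo-Cauchy sequence in $K$: $I$ is well-ordered with at least two elements and $v(a_i-a_j)<v(a_j-a_k)$ for $i<j<k$. Let $I^*$ be $I$ without its maximum (if there is one), and for $i\in I^*$ let $\gamma_i=v(a_{i+1}-a_i)$ and let $\nu_i=v_{a_i,\gamma_i}$ be the valuation $\sum_n c_n(x-a_i)^n\mapsto\min_n\{v(c_n)+n\gamma_i\}$. A polynomial $f\in K[x]$ is *fixed* by $\underline a$ if $v(f(a_i))$ is constant for all large $i\in I^*$. Assume that $\underline a$ is of algebraic type: $I^*$ has no maximum and some polynomial is not fixed. Let $F$ be a monic polynomial of smallest degree among the polynomials not fixed by $\underline a$, and let $\delta=(\delta^L,\delta^R)$ be the cut in $\Gamma_{\mathbb Q}$ with $\delta^L=\{\beta\in\Gamma_{\mathbb Q}\mid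 \beta\le\nu_i(F)\text{ for some } i\in I^*\}$ and $\delta^R=\Gamma_{\mathbb Q}\setminus\delta^L$. For $\alpha\in\Lambda_\infty$ put $$\mu_{F,\alpha}(f)=\min_n\{\nu(f_n)+n\alpha\},$$ where $f=\sum_n f_nF^n$ with $\deg f_n<\deg F$ and $\nu(f_n)$ is the ultimately constant value of $\nu_i(f_n)$. **Proposition.** 1. The cut $\delta$ does not depend on the choice of $F$, and there is $\gamma\in\Lambda$ that induces it, i.e. $\delta^L=\{\beta\in\Gamma_{\mathbb Q}\mid\beta\le\gamma\}$ and $\delta^R=\{\beta\in\Gamma_{\mathbb Q}\mid\beta\ge\gamma\}$ (so that $\gamma$ represents $\sup\delta^L$). 2. For every such $\gamma$: the map $\mu_{F,\alpha}$ is a valuation belonging to $\mathcal V$ for every $\alpha\in\Lambda_\infty$ with $\alpha\ge\gamma$; $\mu_{F,\gamma}$ is a supremum up to equivalence of $(\nu_i)_{i\in I^*}$ in $\mathcal V$, and every other such supremum is equivalent to it; and $\mu_{F,\gamma}=\mu_{G,\gamma}$ for every monic polynomial $G$ of smallest degree not fixed by $\underline a$. 3. If $\delta^L=\Gamma_{\mathbb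 Q}$, then $\mu_{F,\infty}$ is the least valuation $\mu'$ among those $\mu'\in\mathcal V$ for which $\nu_i\le\mu'$ for all $i\in I^*$ and no finite value of $\mu'$ is an upper bound of $\Gamma_{\mathbb Q}$; and $\mu_{F,\infty}=\mu_{G,\infty}$ for every monic polynomial $G$ of smallest degree not fixed by $\underline a$. -/

import Mathlib

open Polynomial

noncomputable section

namespace PseudoCauchy

/-! ### The container of values: Hahn products and small extensions -/

/-- The index set `𝕀 = I ⊔ {i_S | S an initial segment of I}`. -/
inductive ExtIndex (I : Type*) [LinearOrder I] : Type _
  | idx : I → ExtIndex I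
  | gap : LowerSet I → ExtIndex I

namespace ExtIndex

variable {I : Type*} [LinearOrder I]

/-- An auxiliary key that produces the order of `𝕀`; the resulting order is made explicit in
`idx_lt_idx`, `idx_lt_gap`, `gap_lt_idx` and `gap_lt_gap`. -/
def key : ExtIndex I → LowerSet I ×ₗ Bool
  | idx i => toLex (LowerSet.Iic i, false)
  | gap S => toLex (S, true)

theorem key_injective : Function.Injective (key (I := I)) := by
  rintro (i | S) (j | T) h
  · have h1 : LowerSet.Iic i = LowerSet.Iic j := congrArg (fun p => (ofLex p).1) h
    have h2 : i ≤ j := by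
      have : i ∈ LowerSet.Iic i := by simp
      rw [h1] at this
      simpa using this
    have h3 : j ≤ i := by
      have : j ∈ LowerSet.Iic j := by simp
      rw [← h1] at this
      simpa using this
    rw [le_antisymm h2 h3]
  · have h1 : false = true := congrArg (fun p => (ofLex p).2) h
    cases h1
  · have h1 : true = false := congrArg (fun p => (ofLex p).2) h
    cases h1
  · have h1 : S = T := congrArg (fun p => (ofLex p).1) h
    rw [h1]

instance : LinearOrder (ExtIndex I) := LinearOrder.lift' key key_injective

theorem lt_iff_key (x y : ExtIndex I) : x < y ↔ key x < key y := Iff.rfl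

theorem idx_lt_idx (i j : I) : idx i < idx j ↔ i < j := by
  rw [lt_iff_key, key, key, Prod.Lex.toLex_lt_toLex]
  simp only [lt_self_iff_false, and_false, or_false]
  rw [← not_le, ← not_le, LowerSet.Iic_le, LowerSet.mem_Iic_iff]

theorem gap_lt_gap (S T : LowerSet I) : gap S < gap T ↔ S < T := by
  rw [lt_iff_key, key, key, Prod.Lex.toLex_lt_toLex]
  simp

theorem idx_lt_gap (i : I) (S : LowerSet I) : idx i < gap S ↔ i ∈ S := by
  rw [lt_iff_key, key, key, Prod.Lex.toLex_lt_toLex]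
  have h : i ∈ S ↔ LowerSet.Iic i ≤ S := LowerSet.Iic_le.symm
  rw [h, le_iff_lt_or_eq]
  simp

theorem gap_lt_idx (S : LowerSet I) (i : I) : gap S < idx i ↔ i ∉ S := by
  rw [← idx_lt_gap, not_lt]
  constructor
  · exact le_of_lt
  · intro h
    exact lt_of_le_of_ne h (by simp)

/-- The inclusion of `I` in `𝕀`. -/
def idxEmb (I : Type*) [LinearOrder I] : I ↪o ExtIndex I :=
  OrderEmbedding.ofStrictMono idx fun _ _ h => (idx_lt_idx _ _).2 h

end ExtIndex

/-- The Hahn product `ℝ^I_lex`: real families with well-ordered support, ordered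
lexicographically. -/
abbrev Hahn (I : Type*) [LinearOrder I] : Type _ := Lex (HahnSeries I ℝ)

/-- The inclusion `ℝ^I_lex ⊆ ℝ^𝕀_lex` (extension by zero). -/
def hahnIncl (I : Type*) [LinearOrder I] : Hahn I →+ Hahn (ExtIndex I) where
  toFun x := toLex (HahnSeries.embDomain (ExtIndex.idxEmb I) (ofLex x))
  map_zero' := by
    change toLex (HahnSeries.embDomain (ExtIndex.idxEmb I) 0) = 0
    rw [HahnSeries.embDomain_zero]
    rfl
  map_add' x y := by
    change toLex (HahnSeries.embDomain (ExtIndex.idxEmb I) (ofLex x + ofLex y)) = _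
    rw [HahnSeries.embDomain_add]
    rfl

/-- `ℝ_sme`, the union over the initial segments `S` of `I` of the subgroups
`ℝ^{I_S}_lex ⊆ ℝ^𝕀_lex`, where `I_S = I ⊔ {i_S}`. -/
def smallExt (I : Type*) [LinearOrder I] : Set (Hahn (ExtIndex I)) :=
  {x | ∃ S : LowerSet I,
    (ofLex x).support ⊆ Set.range (ExtIndex.idx (I := I)) ∪ {ExtIndex.gap S}}

/-! ### Valuations on polynomials -/

section Valuations

variable {K Γ Λ Λ' : Type*} [Field K]
  [AddCommGroup Γ] [LinearOrder Γ] [IsOrderedAddMonoid Γ]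
  [AddCommGroup Λ] [LinearOrder Λ] [IsOrderedAddMonoid Λ]

/-- The coefficients of the `q`-expansion `f = f₀ + f₁ q + ⋯ + f_r q^r`, for `q` monic of positive
degree. -/
def expCoeff (q f : K[X]) (n : ℕ) : K[X] := ((fun g => g /ₘ q)^[n] f) %ₘ q

/-- The map `μ_{q,α}`: `f₀ + f₁ q + ⋯ + f_r q^r ↦ min_n (μ(f_n) + n α)`. For `q` monic of positive
degree the coefficients with index greater than `deg f` vanish. -/
def augment (μ : K[X] → WithTop Λ) (q : K[X]) (α : WithTop Λ) (f : K[X]) : WithTop Λ :=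
  (Finset.range (f.natDegree + 1)).inf fun n => μ (expCoeff q f n) + n • α

/-- The map `v_{a,γ}`, for a valuation `v` on `K` whose values are read in `Λ` through `e`. -/
def monomialVal (v : AddValuation K (WithTop Γ)) (e : Γ →+ Λ) (a : K) (γ : WithTop Λ) :
    K[X] → WithTop Λ :=
  augment (fun g => (v (g.coeff 0)).map e) (X - C a) γ

/-- The set `𝒱` of the valuations on `K[x]` that extend `v` and take their values in `D ∪ {∞}`,
where `D` is a subset of `Λ`. -/
def extVals (v : AddValuation K (WithTop Γ)) (e : Γ →+ Λ) (D : Set Λ) :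
    Set (K[X] → WithTop Λ) :=
  {μ | (∃ w : AddValuation K[X] (WithTop Λ), ∀ f, w f = μ f) ∧
    (∀ c : K, μ (C c) = (v c).map e) ∧
    ∀ f, μ f = ⊤ ∨ ∃ x ∈ D, μ f = (x : WithTop Λ)}

/-- The value group of `μ`: the subgroup generated by the finite values. -/
def valueGroup (μ : K[X] → WithTop Λ) : AddSubgroup Λ :=
  AddSubgroup.closure {x | ∃ f, μ f = (x : WithTop Λ)}

/-- Equivalence of valuations: an isomorphism of ordered groups between the value groups carries
`μ` to `μ'`. -/
def Equivalent (μ μ' : K[X] → WithTop Λ) : Prop :=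
  ∃ τ : valueGroup μ ≃+o valueGroup μ', ∀ f,
    (μ f = ⊤ → μ' f = ⊤) ∧
    ∀ x : valueGroup μ, μ f = ((x : Λ) : WithTop Λ) → μ' f = ((τ x : Λ) : WithTop Λ)

/-- `μ` is a supremum, up to equivalence, of the family `ν` in the set `V` of valuations: it lies
in `V`, it is an upper bound for the pointwise order, and below every upper bound in `V` there is a
member of `V` equivalent to `μ`. -/
structure IsSup {J : Type*} (V : Set (K[X] → WithTop Λ)) (ν : J → K[X] → WithTop Λ)
    (μ : K[X] → WithTop Λ) : Prop where
  mem : μ ∈ V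
  upper : ∀ i, ν i ≤ μ
  least : ∀ μ' ∈ V, (∀ i, ν i ≤ μ') → ∃ μ'' ∈ V, Equivalent μ'' μ ∧ μ'' ≤ μ'

/-- `f` is stable for the family `ν`: its value is ultimately constant. -/
def IsStable {J : Type*} [LE J] (ν : J → K[X] → WithTop Λ) (f : K[X]) : Prop :=
  ∃ i₀, ∀ i, i₀ ≤ i → ν i f = ν i₀ f

open Classical in
/-- The ultimate value of a stable polynomial (and `∞` by convention for the other ones). -/
def stableVal {J : Type*} [LE J] (ν : J → K[X] → WithTop Λ) (f : K[X]) : WithTop Λ :=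
  if h : IsStable ν f then ν h.choose f else ⊤

/-- The divisible closure `Γ_ℚ` of (the image of) `Γ` in `Λ`, for a divisible group `Λ`. -/
def divClosure (e : Γ →+ Λ) : Set Λ := {x | ∃ n : ℕ, 0 < n ∧ n • x ∈ Set.range e}

/-- The quasi-cut `(δ^L, δ^R)` that an element of `Λ` induces on a subset `D`. -/
def quasiCut (D : Set Λ) (γ : Λ) : Set Λ × Set Λ := ({x ∈ D | x ≤ γ}, {x ∈ D | γ ≤ x})

/-- The cut of `D` whose left cut set consists of the elements that are bounded above by one of the
values `ν i f`. -/
def cutOf {J : Type*} (D : Set Λ) (ν : J → K[X] → WithTop Λ) (f : K[X]) : Set Λ × Set Λ :=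
  ({x ∈ D | ∃ i, (x : WithTop Λ) ≤ ν i f}, {x ∈ D | ¬ ∃ i, (x : WithTop Λ) ≤ ν i f})

end Valuations

/-! ### Pseudo-Cauchy sequences -/

section Sequences

variable {K Γ Λ I : Type*} [Field K]
  [AddCommGroup Γ] [LinearOrder Γ] [IsOrderedAddMonoid Γ]
  [AddCommGroup Λ] [LinearOrder Λ] [IsOrderedAddMonoid Λ] [LinearOrder I]

/-- `v(a_i - a_j) < v(a_j - a_k)` whenever `i < j < k`. -/
def IsPseudoCauchy (v : AddValuation K (WithTop Γ)) (a : I → K) : Prop :=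
  ∀ i j k, i < j → j < k → v (a i - a j) < v (a j - a k)

/-- `I^*`: the index set `I` without its maximum, if there is one. -/
abbrev Star (I : Type*) [LinearOrder I] : Type _ := {i : I // ¬ IsMax i}

/-- `f` is fixed by the sequence: `v(f(a_i))` is ultimately constant along `I^*`. -/
def IsFixed (v : AddValuation K (WithTop Γ)) (a : I → K) (f : K[X]) : Prop :=
  ∃ i₀ : Star I, ∀ i : Star I, i₀ ≤ i → v (f.eval (a i)) = v (f.eval (a i₀))

/-- The sequence is of algebraic type: `I^*` has no maximum and some polynomial is not fixed. -/
def IsAlgebraicType (v : AddValuation K (WithTop Γ)) (a : I → K) : Prop :=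
  (∀ i : Star I, ∃ j : Star I, i < j) ∧ ∃ f : K[X], ¬ IsFixed v a f

/-- `F` is a monic polynomial of smallest degree among the polynomials that are not fixed. -/
def IsMinNotFixed (v : AddValuation K (WithTop Γ)) (a : I → K) (F : K[X]) : Prop :=
  F.Monic ∧ ¬ IsFixed v a F ∧ ∀ g : K[X], ¬ IsFixed v a g → F.natDegree ≤ g.natDegree

variable [SuccOrder I]

/-- The family `ν_i = v_{a_i,γ_i}`, `i ∈ I^*`, with `γ_i = v(a_{i+1} - a_i)`. -/
def seqVal (v : AddValuation K (WithTop Γ)) (e : Γ →+ Λ) (a : I → K) (i : Star I) :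
    K[X] → WithTop Λ :=
  monomialVal v e (a i) ((v (a (Order.succ (i : I)) - a i)).map e)

/-- The map `μ_{F,α}` attached to the family `(ν_i)`: it sends `f₀ + f₁ F + ⋯ + f_r F^r` to the
minimum of the `w(f_n) + n α`, where `w(f_n)` is the ultimate value of `ν_i(f_n)`. -/
def limitVal (v : AddValuation K (WithTop Γ)) (e : Γ →+ Λ) (a : I → K) (F : K[X])
    (α : WithTop Λ) : K[X] → WithTop Λ :=
  augment (stableVal (seqVal v e a)) F α

end Sequences

/-- The embedding of `Γ` in `ℝ^𝕀_lex` given by an embedding of `Γ` in `ℝ^I_lex`, where `I` is the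
set of archimedean classes of non-zero elements of `Γ` (that is, of non-zero principal convex
subgroups, by decreasing inclusion). -/
def bigEmb {Γ : Type*} [AddCommGroup Γ] [LinearOrder Γ] [IsOrderedAddMonoid Γ]
    (ι : Γ →+o Hahn (FiniteArchimedeanClass Γ)) :
    Γ →+ Hahn (ExtIndex (FiniteArchimedeanClass Γ)) :=
  (hahnIncl (FiniteArchimedeanClass Γ)).comp (ι : Γ →+ Hahn (FiniteArchimedeanClass Γ))

end PseudoCauchy

end

set_option linter.unusedSectionVars false

/-! A fixed polynomial is a stable one: expanding `f` around a later centre, `v(f(a_i))` can differ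
from `ν_i(f)` only when two terms share the minimum, and each time this happens the minimizing
exponent drops, so it happens at most `deg f` times (`HasRadii.eventually_eval_eq`). The family
`ν_i` is therefore increasing, strictly so on unfixed polynomials, and everything of degree below
`deg F` has an ultimate value `w`.

The key observation is that two affine functions `g + n t` and `g' + n' t` with `g, g'` in `Γ` and
`n ≠ n'` cross at a single point of the divisible closure. The values `ν_i(F)` end up strictly on
one side of this point, and so does every `γ` realizing the cut, which is never itself in the
divisible closure (`lt_or_lt`). Hence the terms of an `F`-expansion have distinct values at `γ`,
ordered as they are for large `i`: the term giving `μ_{F,γ}(f)` also gives `ν_i(f)` eventually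
(`exists_leading_term`). For a product of two polynomials of degree below `deg F` the value is
ultimately constant, so the leading exponent is `0`. This is the hypothesis `IsKey`, under which a
Gauss lemma argument makes `μ_{F,α}` a valuation for all `α ≥ γ`.

An upper bound `μ'` dominates `μ_{F,γ}` if `μ'(F) ≥ γ`. Otherwise `γ' = μ'(F)` realizes the same
cut, and `μ_{F,γ'}` lies below `μ'` and is equivalent to `μ_{F,γ}`, because `γ` and `γ'` induce the
same order on `Γ ⊕ ℤ`. In the cofinal case, an upper bound with no finite value above `Γ_ℚ` must
send `F` to `∞`.

The existence of `γ` is a separation theorem in Hahn products (`exists_separating`): follow the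
coefficients for as long as the two sides agree, then put `±1` at the gap index just behind. -/

namespace PseudoCauchy

/-! ### Expansions in powers of a monic polynomial -/

section Expansions

variable {K : Type*} [Field K] {q : K[X]}

theorem expCoeff_zero_right (q f : K[X]) : expCoeff q f 0 = f %ₘ q := rfl

theorem expCoeff_succ (q f : K[X]) (n : ℕ) : expCoeff q f (n + 1) = expCoeff q (f /ₘ q) n := rfl

theorem expCoeff_zero (q : K[X]) (n : ℕ) : expCoeff q 0 n = 0 := by
  induction n with
  | zero => simp [expCoeff_zero_right]
  | succ n ih => rw [expCoeff_succ, zero_divByMonic, ih]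

theorem add_divByMonic (hq : q.Monic) (f g : K[X]) : (f + g) /ₘ q = f /ₘ q + g /ₘ q := by
  refine (div_modByMonic_unique (f /ₘ q + g /ₘ q) (f %ₘ q + g %ₘ q) hq ⟨?_, ?_⟩).1
  · conv_rhs => rw [← modByMonic_add_div f q, ← modByMonic_add_div g q]
    ring
  · exact (degree_add_le _ _).trans_lt
      (max_lt (degree_modByMonic_lt f hq) (degree_modByMonic_lt g hq))

theorem expCoeff_add (hq : q.Monic) (f g : K[X]) (n : ℕ) :
    expCoeff q (f + g) n = expCoeff q f n + expCoeff q g n := by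
  induction n generalizing f g with
  | zero => simp [expCoeff_zero_right, add_modByMonic]
  | succ n ih => rw [expCoeff_succ, add_divByMonic hq, ih]; rfl

theorem expCoeff_sum (hq : q.Monic) {ι : Type*} (s : Finset ι) (f : ι → K[X]) (n : ℕ) :
    expCoeff q (∑ i ∈ s, f i) n = ∑ i ∈ s, expCoeff q (f i) n := by
  classical
  induction s using Finset.induction_on with
  | empty => simp [expCoeff_zero]
  | insert a s ha ih => rw [Finset.sum_insert ha, Finset.sum_insert ha, expCoeff_add hq, ih]

theorem degree_expCoeff_lt (hq : q.Monic) (f : K[X]) (n : ℕ) :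
    (expCoeff q f n).degree < q.degree :=
  degree_modByMonic_lt _ hq

theorem expCoeff_mul_pow_add (hq : q.Monic) (f : K[X]) (k n : ℕ) :
    expCoeff q (f * q ^ k) (n + k) = expCoeff q f n := by
  induction k with
  | zero => simp
  | succ k ih =>
    rw [← add_assoc, expCoeff_succ, pow_succ, ← mul_assoc, mul_comm _ q,
      mul_divByMonic_cancel_left _ hq, ih]

theorem expCoeff_mul_pow_of_lt (hq : q.Monic) (f : K[X]) {k n : ℕ} (h : n < k) :
    expCoeff q (f * q ^ k) n = 0 := by
  obtain ⟨j, rfl⟩ := Nat.exists_eq_add_of_lt h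
  have h1 : f * q ^ (n + j + 1) = (f * q ^ j * q) * q ^ n := by ring
  have h2 := expCoeff_mul_pow_add hq (f * q ^ j * q) n 0
  rw [zero_add] at h2
  rw [h1, h2, expCoeff_zero_right, mul_self_modByMonic hq]

theorem expCoeff_of_degree_lt (hq : q.Monic) {f : K[X]} (hf : f.degree < q.degree) (n : ℕ) :
    expCoeff q f n = if n = 0 then f else 0 := by
  cases n with
  | zero => simpa [expCoeff_zero_right] using (modByMonic_eq_self_iff hq).2 hf
  | succ n => simp [expCoeff_succ, (divByMonic_eq_zero_iff hq).2 hf, expCoeff_zero]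

theorem expCoeff_self (hq : q.Monic) (hq0 : 0 < q.natDegree) (n : ℕ) :
    expCoeff q q n = if n = 1 then 1 else 0 := by
  have h1 : (1 : K[X]).degree < q.degree := by
    rw [degree_one]; exact natDegree_pos_iff_degree_pos.1 hq0
  cases n with
  | zero => simpa using expCoeff_mul_pow_of_lt hq 1 (k := 1) (n := 0) one_pos
  | succ n =>
    have := expCoeff_mul_pow_add hq 1 1 n
    rw [expCoeff_of_degree_lt hq h1] at this
    simpa using this

theorem expCoeff_eq_zero_of_natDegree_lt (hq : q.Monic) (hq0 : 0 < q.natDegree) {f : K[X]}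
    {n : ℕ} (h : f.natDegree < n) : expCoeff q f n = 0 := by
  induction n generalizing f with
  | zero => omega
  | succ n ih =>
    rw [expCoeff_succ]
    rcases Nat.eq_zero_or_pos n with rfl | hn
    · rw [(divByMonic_eq_zero_iff hq).2, expCoeff_zero]
      exact degree_lt_degree (by omega)
    · apply ih
      rw [natDegree_divByMonic f hq]
      omega

theorem sum_expCoeff (hq : q.Monic) (hq0 : 0 < q.natDegree) (f : K[X]) {N : ℕ}
    (h : f.natDegree < N) : ∑ n ∈ Finset.range N, expCoeff q f n * q ^ n = f := by
  induction N generalizing f with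
  | zero => omega
  | succ N ih =>
    rw [Finset.sum_range_succ']
    have h2 : ∑ k ∈ Finset.range N, expCoeff q f (k + 1) * q ^ (k + 1) = q * (f /ₘ q) := by
      rcases Nat.eq_zero_or_pos N with rfl | hN
      · rw [(divByMonic_eq_zero_iff hq).2 (degree_lt_degree (by omega))]
        simp
      · conv_rhs => rw [← ih (f /ₘ q) (by rw [natDegree_divByMonic f hq]; omega)]
        rw [Finset.mul_sum]
        refine Finset.sum_congr rfl fun k _ => ?_
        rw [expCoeff_succ]; ring
    rw [h2, expCoeff_zero_right, pow_zero, mul_one, add_comm, modByMonic_add_div]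

theorem expCoeff_mul_pow (hq : q.Monic) {g : K[X]} (hg : g.degree < q.degree) (n k : ℕ) :
    expCoeff q (g * q ^ n) k = if k = n then g else 0 := by
  rcases lt_or_ge k n with h | h
  · rw [expCoeff_mul_pow_of_lt hq _ h, if_neg h.ne]
  · obtain ⟨j, rfl⟩ := Nat.exists_eq_add_of_le' h
    rw [expCoeff_mul_pow_add hq, expCoeff_of_degree_lt hq hg]
    simp

theorem expCoeff_sub_term (hq : q.Monic) (f : K[X]) (n k : ℕ) :
    expCoeff q (f - expCoeff q f n * q ^ n) k = if k = n then 0 else expCoeff q f k := by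
  have h1 : expCoeff q f k =
      expCoeff q (f - expCoeff q f n * q ^ n) k + expCoeff q (expCoeff q f n * q ^ n) k := by
    rw [← expCoeff_add hq, sub_add_cancel]
  rw [expCoeff_mul_pow hq (degree_expCoeff_lt hq f n)] at h1
  split_ifs with h
  · subst h
    simpa using h1
  · simpa [h] using h1.symm

theorem exists_expCoeff_ne_zero (hq : q.Monic) (hq0 : 0 < q.natDegree) {f : K[X]} (hf : f ≠ 0) :
    ∃ n, expCoeff q f n ≠ 0 := by
  by_contra! h
  apply hf
  rw [← sum_expCoeff hq hq0 f (Nat.lt_succ_self _)]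
  simp [h]

/-- Hence the expansion of a product of two reduced polynomials has at most two terms, a remainder
and a single carry. -/
theorem degree_mul_divByMonic_lt (hq : q.Monic) {f g : K[X]} (hf : f.degree < q.degree)
    (hg : g.degree < q.degree) : (f * g /ₘ q).degree < q.degree := by
  rcases eq_or_ne f 0 with rfl | hf0
  · simpa using hf
  rcases eq_or_ne g 0 with rfl | hg0
  · simpa using hg
  by_cases hz : f * g /ₘ q = 0
  · rw [hz, degree_zero]
    exact bot_lt_of_lt hf
  have h1 := natDegree_lt_natDegree hf0 hf
  have h2 := natDegree_lt_natDegree hg0 hg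
  apply degree_lt_degree
  rw [natDegree_divByMonic _ hq, natDegree_mul hf0 hg0]
  omega

end Expansions

/-! ### Augmentations, and a criterion for them to be valuations -/

section Augment

variable {K Λ : Type*} [Field K] [AddCommGroup Λ] [LinearOrder Λ] [IsOrderedAddMonoid Λ]
  {μ : K[X] → WithTop Λ} {q : K[X]} {α : WithTop Λ}

/-- The terms beyond `natDegree f` vanish and have value `⊤`, so the truncation in `augment` is
harmless. -/
theorem le_augment_iff (hq : q.Monic) (hq0 : 0 < q.natDegree) (h0 : μ 0 = ⊤) (f : K[X])
    (x : WithTop Λ) : x ≤ augment μ q α f ↔ ∀ n, x ≤ μ (expCoeff q f n) + n • α := by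
  rw [augment, Finset.le_inf_iff]
  refine ⟨fun h n => ?_, fun h n _ => h n⟩
  rcases lt_or_ge f.natDegree n with hn | hn
  · rw [expCoeff_eq_zero_of_natDegree_lt hq hq0 hn, h0, top_add]
    exact le_top
  · exact h n (Finset.mem_range.2 (by omega))

theorem augment_le (hq : q.Monic) (hq0 : 0 < q.natDegree) (h0 : μ 0 = ⊤) (f : K[X]) (n : ℕ) :
    augment μ q α f ≤ μ (expCoeff q f n) + n • α :=
  (le_augment_iff hq hq0 h0 f _).1 le_rfl n

theorem exists_augment_eq (μ : K[X] → WithTop Λ) (q : K[X]) (α : WithTop Λ) (f : K[X]) :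
    ∃ n, augment μ q α f = μ (expCoeff q f n) + n • α := by
  obtain ⟨n, -, h⟩ := Finset.exists_mem_eq_inf (Finset.range (f.natDegree + 1)) ⟨0, by simp⟩
    (fun n => μ (expCoeff q f n) + n • α)
  exact ⟨n, h⟩

theorem lt_augment_sub_term (hq : q.Monic) (h0 : μ 0 = ⊤) {f : K[X]} {n : ℕ} {x : WithTop Λ}
    (hx : x < ⊤) (h : ∀ k, k ≠ n → x < μ (expCoeff q f k) + k • α) :
    x < augment μ q α (f - expCoeff q f n * q ^ n) := by
  obtain ⟨k, hk⟩ := exists_augment_eq μ q α (f - expCoeff q f n * q ^ n)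
  rw [hk, expCoeff_sub_term hq]
  split_ifs with hkn
  · rwa [h0, top_add]
  · exact h k hkn

theorem augment_mono {μ' : K[X] → WithTop Λ} {α' : WithTop Λ} (hq : q.Monic)
    (hμ : ∀ f, f.degree < q.degree → μ f ≤ μ' f) (hα : α ≤ α') (f : K[X]) :
    augment μ q α f ≤ augment μ' q α' f := by
  refine Finset.inf_mono_fun fun n _ => ?_
  exact add_le_add (hμ _ (degree_expCoeff_lt hq f n)) (nsmul_le_nsmul_right hα n)

/-- The ultrametric inequality applied to the expansion of `f`. Every minimality statement below
rests on it. -/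
theorem augment_le_valuation (hq : q.Monic) (hq0 : 0 < q.natDegree)
    (w : AddValuation K[X] (WithTop Λ)) (hμ : ∀ f, f.degree < q.degree → μ f ≤ w f)
    (hα : α ≤ w q) (f : K[X]) : augment μ q α f ≤ w f := by
  conv_rhs => rw [← sum_expCoeff hq hq0 f (Nat.lt_succ_self _)]
  refine w.map_le_sum fun n hn => ?_
  rw [w.map_mul, w.map_pow]
  exact (Finset.inf_le hn).trans
    (add_le_add (hμ _ (degree_expCoeff_lt hq f n)) (nsmul_le_nsmul_right hα n))

theorem augment_of_degree_lt (hq : q.Monic) (hq0 : 0 < q.natDegree) (h0 : μ 0 = ⊤) {f : K[X]}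
    (hf : f.degree < q.degree) : augment μ q α f = μ f := by
  apply le_antisymm
  · simpa [expCoeff_of_degree_lt hq hf] using augment_le (α := α) hq hq0 h0 f 0
  · rw [le_augment_iff hq hq0 h0]
    intro n
    rw [expCoeff_of_degree_lt hq hf]
    split_ifs with hn
    · simp [hn]
    · simp [h0]

theorem augment_self (hq : q.Monic) (hq0 : 0 < q.natDegree) (h0 : μ 0 = ⊤) (h1 : μ 1 = 0) :
    augment μ q α q = α := by
  apply le_antisymm
  · simpa [expCoeff_self hq hq0, h1] using augment_le (α := α) hq hq0 h0 q 1
  · rw [le_augment_iff hq hq0 h0]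
    intro n
    rw [expCoeff_self hq hq0]
    split_ifs with hn
    · simp [hn, h1]
    · simp [h0]

theorem augment_top (hq : q.Monic) (hq0 : 0 < q.natDegree) (h0 : μ 0 = ⊤) (f : K[X]) :
    augment μ q ⊤ f = μ (f %ₘ q) := by
  apply le_antisymm
  · simpa [expCoeff_zero_right] using augment_le (α := ⊤) hq hq0 h0 f 0
  · rw [le_augment_iff hq hq0 h0]
    intro n
    cases n with
    | zero => simp [expCoeff_zero_right]
    | succ n => simp [succ_nsmul]

/-- The conditions under which `augment μ q α` is a valuation: on the polynomials of degree less
than `deg q`, the map `μ` behaves as a valuation modulo `q`, and the quotients by `q` have large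
value. -/
structure IsKey (μ : K[X] → WithTop Λ) (q : K[X]) (α : WithTop Λ) : Prop where
  monic : q.Monic
  pos : 0 < q.natDegree
  map_zero : μ 0 = ⊤
  map_one : μ 1 = 0
  ne_top : ∀ f, f.degree < q.degree → f ≠ 0 → μ f ≠ ⊤
  add : ∀ f g, f.degree < q.degree → g.degree < q.degree → min (μ f) (μ g) ≤ μ (f + g)
  mul : ∀ f g, f.degree < q.degree → g.degree < q.degree → μ (f * g %ₘ q) = μ f + μ g
  lt : ∀ f g, f.degree < q.degree → g.degree < q.degree → f ≠ 0 → g ≠ 0 →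
    μ f + μ g < μ (f * g /ₘ q) + α

namespace IsKey

theorem degree_one_lt (h : IsKey μ q α) : (1 : K[X]).degree < q.degree := by
  rw [degree_one]; exact natDegree_pos_iff_degree_pos.1 h.pos

theorem map_neg (h : IsKey μ q α) {f : K[X]} (hf : f.degree < q.degree) : μ (-f) = μ f := by
  have h1 := h.degree_one_lt
  have hm1 : (-1 : K[X]).degree < q.degree := by rwa [degree_neg]
  -- The double of `μ (-1)` is `μ 1 = 0`, and an ordered group has no torsion.
  have h2 : μ (-1) = 0 := by
    have := h.mul (-1) (-1) hm1 hm1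
    rw [neg_mul_neg, one_mul, (modByMonic_eq_self_iff h.monic).2 h1, h.map_one] at this
    have h3 := h.ne_top (-1) hm1 (by simp)
    lift μ (-1) to Λ using h3 with y
    norm_cast at this ⊢
    rcases lt_trichotomy y 0 with hy | hy | hy
    · exact absurd this (add_neg hy hy).ne
    · exact hy
    · exact absurd this (add_pos hy hy).ne'
  have := h.mul f (-1) hf hm1
  rwa [mul_neg_one, h2, add_zero, (modByMonic_eq_self_iff h.monic).2 (by rwa [degree_neg])] at this

theorem map_add_eq (h : IsKey μ q α) {f g : K[X]} (hf : f.degree < q.degree)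
    (hg : g.degree < q.degree) (hlt : μ f < μ g) : μ (f + g) = μ f := by
  apply le_antisymm
  · have h1 := h.add (f + g) (-g) ((degree_add_le _ _).trans_lt (max_lt hf hg)) (by rwa [degree_neg])
    rw [add_neg_cancel_right, h.map_neg hg] at h1
    rcases min_le_iff.1 h1 with h2 | h2
    · exact h2
    · exact absurd h2 (not_le.2 hlt)
  · simpa [hlt.le] using h.add f g hf hg

/-- An arbitrary upward closed `P` covers both bounds `c ≤ ·` and `c < ·`; `P ⊤` accounts for the
empty sum. -/
theorem sum_bound (h : IsKey μ q α) {ι : Type*} (s : Finset ι) (f : ι → K[X])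
    (P : WithTop Λ → Prop) (hP : P ⊤) (hP' : ∀ x y, x ≤ y → P x → P y)
    (hf : ∀ i ∈ s, (f i).degree < q.degree ∧ P (μ (f i))) :
    (∑ i ∈ s, f i).degree < q.degree ∧ P (μ (∑ i ∈ s, f i)) := by
  refine Finset.sum_induction f (fun p => p.degree < q.degree ∧ P (μ p)) ?_ ?_ hf
  · rintro a b ⟨ha, ha'⟩ ⟨hb, hb'⟩
    refine ⟨(degree_add_le _ _).trans_lt (max_lt ha hb), ?_⟩
    refine hP' _ _ (h.add a b ha hb) ?_
    rcases min_choice (μ a) (μ b) with hm | hm <;> rw [hm] <;> assumption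
  · rw [h.map_zero]
    refine ⟨?_, hP⟩
    rw [degree_zero, bot_lt_iff_ne_bot]
    exact fun hb => h.monic.ne_zero (degree_eq_bot.1 hb)

theorem augment_zero (h : IsKey μ q α) : augment μ q α 0 = ⊤ := by
  rw [augment_of_degree_lt h.monic h.pos h.map_zero, h.map_zero]
  rw [degree_zero]; exact bot_lt_of_lt h.degree_one_lt

theorem augment_eq_top_iff (h : IsKey μ q α) (hα : α ≠ ⊤) (f : K[X]) :
    augment μ q α f = ⊤ ↔ f = 0 := by
  constructor
  · intro ht
    by_contra hf
    obtain ⟨n, hn⟩ := exists_expCoeff_ne_zero h.monic h.pos hf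
    have h1 := augment_le (α := α) h.monic h.pos h.map_zero f n
    rw [ht, top_le_iff, WithTop.add_eq_top] at h1
    rcases h1 with h1 | h1
    · exact h.ne_top _ (degree_expCoeff_lt h.monic f n) hn h1
    · lift α to Λ using hα
      exact WithTop.coe_ne_top (h1 : ((n • α : Λ) : WithTop Λ) = ⊤)
  · rintro rfl
    exact h.augment_zero

/-- Writing `f * g = r + s q` with reduced `r` and `s`, only the exponents `k + l` and `k + l + 1`
occur; `mul` handles the first and `lt` the carry. -/
theorem le_term (h : IsKey μ q α) {f g : K[X]} (hf : f.degree < q.degree)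
    (hg : g.degree < q.degree) (k l n : ℕ) :
    (μ f + k • α) + (μ g + l • α) ≤ μ (expCoeff q (f * g * q ^ (k + l)) n) + n • α := by
  rcases eq_or_ne f 0 with rfl | hf0
  · simp [expCoeff_zero, h.map_zero]
  rcases eq_or_ne g 0 with rfl | hg0
  · simp [expCoeff_zero, h.map_zero]
  have hr : (μ f + k • α) + (μ g + l • α) = (μ f + μ g) + (k + l) • α := by
    rw [add_nsmul]; abel
  rw [hr]
  rcases lt_or_ge n (k + l) with hn | hn
  · rw [expCoeff_mul_pow_of_lt h.monic _ hn, h.map_zero, top_add]; exact le_top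
  obtain ⟨j, rfl⟩ := Nat.exists_eq_add_of_le' hn
  rw [expCoeff_mul_pow_add h.monic]
  match j with
  | 0 => rw [expCoeff_zero_right, h.mul f g hf hg, zero_add]
  | 1 =>
    rw [expCoeff_succ, expCoeff_zero_right,
      (modByMonic_eq_self_iff h.monic).2 (degree_mul_divByMonic_lt h.monic hf hg), add_nsmul _ 1,
      one_nsmul, ← add_assoc]
    exact add_le_add (h.lt f g hf hg hf0 hg0).le le_rfl
  | j + 2 =>
    rw [expCoeff_succ, expCoeff_of_degree_lt h.monic (degree_mul_divByMonic_lt h.monic hf hg)]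
    simp [h.map_zero]

/-- Carries are strictly larger, so they never compete for the minimum. A finite `α` keeps the
inequality strict after adding multiples of it. -/
theorem lt_term (h : IsKey μ q α) (hα : α ≠ ⊤) {f g : K[X]} (hf : f.degree < q.degree)
    (hg : g.degree < q.degree) (hf0 : f ≠ 0) (hg0 : g ≠ 0) (k l n : ℕ) (hn : k + l ≠ n) :
    (μ f + k • α) + (μ g + l • α) < μ (expCoeff q (f * g * q ^ (k + l)) n) + n • α := by
  have hr : (μ f + k • α) + (μ g + l • α) = (μ f + μ g) + (k + l) • α := by
    rw [add_nsmul]; abel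
  have hα' : ∀ m : ℕ, m • α ≠ ⊤ := by
    lift α to Λ using hα
    exact fun m => (WithTop.coe_ne_top : ((m • α : Λ) : WithTop Λ) ≠ ⊤)
  have hfin : (μ f + μ g) + (k + l) • α < ⊤ := by
    rw [lt_top_iff_ne_top, WithTop.add_ne_top, WithTop.add_ne_top]
    exact ⟨⟨h.ne_top f hf hf0, h.ne_top g hg hg0⟩, hα' _⟩
  rw [hr]
  rcases lt_or_gt_of_ne hn with hn | hn
  swap
  · rwa [expCoeff_mul_pow_of_lt h.monic _ hn, h.map_zero, top_add]
  obtain ⟨j, rfl⟩ := Nat.exists_eq_add_of_le' hn.le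
  rw [expCoeff_mul_pow_add h.monic]
  match j with
  | 0 => omega
  | 1 =>
    rw [expCoeff_succ, expCoeff_zero_right,
      (modByMonic_eq_self_iff h.monic).2 (degree_mul_divByMonic_lt h.monic hf hg), add_nsmul _ 1,
      one_nsmul, ← add_assoc]
    exact WithTop.add_lt_add_right (hα' _) (h.lt f g hf hg hf0 hg0)
  | j + 2 =>
    rw [expCoeff_succ, expCoeff_of_degree_lt h.monic (degree_mul_divByMonic_lt h.monic hf hg)]
    simpa [h.map_zero] using hfin

theorem mul_eq_sum (h : IsKey μ q α) (f g : K[X]) (n : ℕ) :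
    expCoeff q (f * g) n =
      ∑ p ∈ Finset.range (f.natDegree + 1) ×ˢ Finset.range (g.natDegree + 1),
        expCoeff q (expCoeff q f p.1 * expCoeff q g p.2 * q ^ (p.1 + p.2)) n := by
  rw [← expCoeff_sum h.monic]
  congr 1
  conv_lhs => rw [← sum_expCoeff h.monic h.pos f (Nat.lt_succ_self _),
    ← sum_expCoeff h.monic h.pos g (Nat.lt_succ_self _)]
  rw [Finset.sum_mul_sum, ← Finset.sum_product']
  refine Finset.sum_congr rfl fun p _ => ?_
  ring

theorem exists_least (h : IsKey μ q α) (hα : α ≠ ⊤) {f : K[X]} (hf : f ≠ 0) :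
    ∃ n, augment μ q α f = μ (expCoeff q f n) + n • α ∧ n ≤ f.natDegree ∧
      expCoeff q f n ≠ 0 ∧ ∀ k < n, augment μ q α f < μ (expCoeff q f k) + k • α := by
  classical
  have hex := exists_augment_eq μ q α f
  have hz : expCoeff q f (Nat.find hex) ≠ 0 := by
    intro h0
    have h1 := Nat.find_spec hex
    rw [h0, h.map_zero, top_add, h.augment_eq_top_iff hα] at h1
    exact hf h1
  refine ⟨Nat.find hex, Nat.find_spec hex, ?_, hz, fun k hk => ?_⟩
  · by_contra hlt
    exact hz (expCoeff_eq_zero_of_natDegree_lt h.monic h.pos (not_le.1 hlt))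
  · exact lt_of_le_of_ne (augment_le h.monic h.pos h.map_zero f k) (Nat.find_min hex hk)

/-- As in Gauss's lemma: with `n` and `m` the least exponents attaining the minima of `f` and `g`,
the coefficient of `q ^ (n + m)` receives exactly one contribution of minimal value. For `α = ⊤`
only remainders modulo `q` count. -/
theorem augment_mul (h : IsKey μ q α) (f g : K[X]) :
    augment μ q α (f * g) = augment μ q α f + augment μ q α g := by
  rcases eq_or_ne α ⊤ with rfl | hα
  · simp only [augment_top h.monic h.pos h.map_zero]
    rw [mul_modByMonic, h.mul _ _ (degree_modByMonic_lt _ h.monic) (degree_modByMonic_lt _ h.monic)]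
  rcases eq_or_ne f 0 with rfl | hf
  · rw [zero_mul, h.augment_zero, top_add]
  rcases eq_or_ne g 0 with rfl | hg
  · rw [mul_zero, h.augment_zero, add_top]
  have hlo := degree_expCoeff_lt h.monic
  have hge : ∀ k l n, augment μ q α f + augment μ q α g ≤
      μ (expCoeff q (expCoeff q f k * expCoeff q g l * q ^ (k + l)) n) + n • α := fun k l n =>
    (add_le_add (augment_le h.monic h.pos h.map_zero f k)
      (augment_le h.monic h.pos h.map_zero g l)).trans (h.le_term (hlo f k) (hlo g l) k l n)
  apply le_antisymm
  · obtain ⟨n, hn, hnd, hn0, hnk⟩ := h.exists_least hα hf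
    obtain ⟨m, hm, hmd, hm0, hmk⟩ := h.exists_least hα hg
    have hAf : augment μ q α f ≠ ⊤ := fun h1 => hf ((h.augment_eq_top_iff hα f).1 h1)
    have hAg : augment μ q α g ≠ ⊤ := fun h1 => hg ((h.augment_eq_top_iff hα g).1 h1)
    have hα' : (n + m) • α ≠ ⊤ := by
      lift α to Λ using hα
      exact (WithTop.coe_ne_top : (((n + m) • α : Λ) : WithTop Λ) ≠ ⊤)
    set T : ℕ × ℕ → K[X] := fun p =>
      expCoeff q (expCoeff q f p.1 * expCoeff q g p.2 * q ^ (p.1 + p.2)) (n + m) with hT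
    have hmain : μ (T (n, m)) + (n + m) • α = augment μ q α f + augment μ q α g := by
      have h1 := expCoeff_mul_pow_add h.monic (expCoeff q f n * expCoeff q g m) (n + m) 0
      rw [zero_add] at h1
      simp only [hT]
      rw [h1, expCoeff_zero_right, h.mul _ _ (hlo f n) (hlo g m), hn, hm, add_nsmul]
      abel
    -- If `k + l = n + m`, then `k < n` or `l < m`, and minimality of `n` or `m` gives strictness;
    -- otherwise the contribution is a carry or zero.
    have hother : ∀ p, p ≠ (n, m) →
        augment μ q α f + augment μ q α g < μ (T p) + (n + m) • α := by
      rintro ⟨k, l⟩ hp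
      have htop : augment μ q α f + augment μ q α g < ⊤ := by
        rw [lt_top_iff_ne_top, WithTop.add_ne_top]; exact ⟨hAf, hAg⟩
      by_cases hkf : expCoeff q f k = 0
      · simpa [hT, hkf, expCoeff_zero, h.map_zero] using htop
      by_cases hlg : expCoeff q g l = 0
      · simpa [hT, hlg, expCoeff_zero, h.map_zero] using htop
      by_cases hkl : k + l = n + m
      · have hlt : augment μ q α f + augment μ q α g <
            (μ (expCoeff q f k) + k • α) + (μ (expCoeff q g l) + l • α) := by
          have h1 := augment_le (α := α) h.monic h.pos h.map_zero f k
          have h2 := augment_le (α := α) h.monic h.pos h.map_zero g l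
          rcases lt_trichotomy k n with hk | hk | hk
          · exact WithTop.add_lt_add_of_lt_of_le hAg (hnk k hk) h2
          · exact absurd (by rw [hk, show l = m by omega]) hp
          · exact WithTop.add_lt_add_of_le_of_lt hAf h1 (hmk l (by omega))
        exact hlt.trans_le (h.le_term (hlo f k) (hlo g l) k l _)
      · exact (add_le_add (augment_le h.monic h.pos h.map_zero f k)
          (augment_le h.monic h.pos h.map_zero g l)).trans_lt
          (h.lt_term hα (hlo f k) (hlo g l) hkf hlg k l _ hkl)
    have hmem : (n, m) ∈ Finset.range (f.natDegree + 1) ×ˢ Finset.range (g.natDegree + 1) := by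
      simp only [Finset.mem_product, Finset.mem_range]; omega
    refine (augment_le h.monic h.pos h.map_zero _ (n + m)).trans ?_
    rw [h.mul_eq_sum, ← Finset.add_sum_erase _ _ hmem, ← hmain]
    have hsum := h.sum_bound
      ((Finset.range (f.natDegree + 1) ×ˢ Finset.range (g.natDegree + 1)).erase (n, m)) T
      (fun x => μ (T (n, m)) < x) ?_ (fun x y hxy hx => hx.trans_le hxy)
      (fun p hp => ⟨hlo _ _, ?_⟩)
    · rw [h.map_add_eq (hlo _ _) hsum.1 hsum.2]
    · rw [lt_top_iff_ne_top]
      intro ht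
      rw [ht, top_add, eq_comm, WithTop.add_eq_top] at hmain
      exact hmain.elim hAf hAg
    · have := hother p (Finset.ne_of_mem_erase hp)
      rw [← hmain] at this
      exact lt_of_add_lt_add_right this
  · rw [le_augment_iff h.monic h.pos h.map_zero]
    intro n
    rw [h.mul_eq_sum]
    refine (h.sum_bound _ _ (fun x => augment μ q α f + augment μ q α g ≤ x + n • α) (by simp)
      (fun x y hxy hx => hx.trans (by gcongr)) fun p _ => ⟨hlo _ _, hge _ _ _⟩).2

theorem augment_add (h : IsKey μ q α) (f g : K[X]) :
    min (augment μ q α f) (augment μ q α g) ≤ augment μ q α (f + g) := by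
  rw [le_augment_iff h.monic h.pos h.map_zero]
  intro n
  have hlo := degree_expCoeff_lt h.monic
  rw [expCoeff_add h.monic]
  refine le_trans ?_ (add_le_add_left (h.add _ _ (hlo f n) (hlo g n)) _)
  rcases min_choice (μ (expCoeff q f n)) (μ (expCoeff q g n)) with hm | hm <;> rw [hm]
  · exact min_le_of_left_le (augment_le h.monic h.pos h.map_zero f n)
  · exact min_le_of_right_le (augment_le h.monic h.pos h.map_zero g n)

/-- The augmentation as a valuation. -/
noncomputable def valuation (h : IsKey μ q α) : AddValuation K[X] (WithTop Λ) :=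
  AddValuation.of (augment μ q α) h.augment_zero
    (by rw [augment_of_degree_lt h.monic h.pos h.map_zero h.degree_one_lt, h.map_one])
    h.augment_add h.augment_mul

theorem valuation_apply (h : IsKey μ q α) (f : K[X]) : h.valuation f = augment μ q α f := rfl

end IsKey

end Augment

/-! ### Monomial valuations -/

section Gauss

variable {K Λ : Type*} [Field K] [AddCommGroup Λ] [LinearOrder Λ] [IsOrderedAddMonoid Λ]
  (u : AddValuation K (WithTop Λ))

/-- The monomial valuation centred at `a` with `x - a` of value `γ`. -/
noncomputable def gauss (a : K) (γ : WithTop Λ) : K[X] → WithTop Λ :=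
  augment (fun g => u (g.coeff 0)) (X - C a) γ

theorem natDegree_X_sub_C_pos (a : K) : 0 < (X - C a).natDegree := by
  rw [natDegree_X_sub_C]; exact one_pos

theorem degree_lt_X_sub_C_iff {a : K} {f : K[X]} :
    f.degree < (X - C a).degree ↔ f = C (f.coeff 0) := by
  rw [degree_X_sub_C]
  constructor
  · intro h
    exact eq_C_of_degree_le_zero (Nat.WithBot.lt_one_iff_le_zero.1 h)
  · intro h
    rw [h]
    exact degree_C_le.trans_lt (by norm_num)

/-- Reduced polynomials modulo `X - C a` are constants, so products produce no carry. -/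
theorem isKey_gauss (a : K) (γ : WithTop Λ) : IsKey (fun g => u (g.coeff 0)) (X - C a) γ where
  monic := monic_X_sub_C a
  pos := natDegree_X_sub_C_pos a
  map_zero := by simp
  map_one := by simp
  ne_top f hf hf0 := by
    rw [degree_lt_X_sub_C_iff] at hf
    simp only [u.ne_top_iff]
    intro h0
    rw [h0, C_0] at hf
    exact hf0 hf
  add f g _ _ := by simp only [coeff_add]; exact u.map_add _ _
  mul f g hf hg := by
    have h : (f * g).degree < (X - C a).degree := by
      rw [degree_lt_X_sub_C_iff] at *
      rw [hf, hg, ← C_mul]; simp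
    rw [(modByMonic_eq_self_iff (monic_X_sub_C a)).2 h, mul_coeff_zero, u.map_mul]
  lt f g hf hg hf0 hg0 := by
    have h : (f * g).degree < (X - C a).degree := by
      rw [degree_lt_X_sub_C_iff] at *
      rw [hf, hg, ← C_mul]; simp
    rw [(divByMonic_eq_zero_iff (monic_X_sub_C a)).2 h, coeff_zero, u.map_zero, top_add,
      ← u.map_mul, lt_top_iff_ne_top, u.ne_top_iff, ← mul_coeff_zero]
    intro h0
    rw [degree_lt_X_sub_C_iff, h0, C_0] at h
    exact mul_ne_zero hf0 hg0 h

/-- `gauss` as a valuation. -/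
noncomputable def gaussVal (a : K) (γ : WithTop Λ) : AddValuation K[X] (WithTop Λ) :=
  (isKey_gauss u a γ).valuation

theorem gaussVal_apply (a : K) (γ : WithTop Λ) (f : K[X]) : gaussVal u a γ f = gauss u a γ f := rfl

theorem gaussVal_C (a c : K) (γ : WithTop Λ) : gaussVal u a γ (C c) = u c := by
  have h := isKey_gauss u a γ
  rw [gaussVal_apply, gauss, augment_of_degree_lt h.monic h.pos h.map_zero
    (degree_lt_X_sub_C_iff.2 (by simp))]
  simp

theorem gaussVal_X_sub_C (a : K) (γ : WithTop Λ) : gaussVal u a γ (X - C a) = γ := by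
  have h := isKey_gauss u a γ
  exact augment_self (μ := fun g => u (g.coeff 0)) h.monic h.pos h.map_zero h.map_one

theorem gaussVal_eq_top_iff (a : K) {γ : WithTop Λ} (hγ : γ ≠ ⊤) (f : K[X]) :
    gaussVal u a γ f = ⊤ ↔ f = 0 :=
  (isKey_gauss u a γ).augment_eq_top_iff hγ f

theorem gaussVal_le {w : AddValuation K[X] (WithTop Λ)} (hw : ∀ c, u c ≤ w (C c)) {a : K}
    {γ : WithTop Λ} (hγ : γ ≤ w (X - C a)) (f : K[X]) : gaussVal u a γ f ≤ w f := by
  refine augment_le_valuation (μ := fun g => u (g.coeff 0)) (monic_X_sub_C a) (natDegree_X_sub_C_pos a) w (fun g hg => ?_) hγ f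
  rw [degree_lt_X_sub_C_iff] at hg
  rw [hg]
  simpa using hw (g.coeff 0)

/-- The valuation on the left is the least extension giving `X - C a` at least the value `γ`, and `X
- C a = (X - C b) - C (a - b)`. Monomial valuations thus depend only on a ball. -/
theorem gaussVal_recenter_le {a b : K} {γ : WithTop Λ} (h : γ ≤ u (a - b)) (f : K[X]) :
    gaussVal u a γ f ≤ gaussVal u b γ f := by
  refine gaussVal_le u (fun c => (gaussVal_C u b c γ).ge) ?_ f
  have h1 : (X - C a : K[X]) = (X - C b) - C (a - b) := by rw [C_sub]; ring
  rw [h1]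
  exact AddValuation.map_le_sub _ (gaussVal_X_sub_C u b γ).ge (by rwa [gaussVal_C])

theorem gaussVal_recenter {a b : K} {γ : WithTop Λ} (h : γ ≤ u (a - b)) :
    gaussVal u a γ = gaussVal u b γ :=
  AddValuation.ext fun f => le_antisymm (gaussVal_recenter_le u h f)
    (gaussVal_recenter_le u (by rwa [u.map_sub_swap]) f)

theorem gaussVal_le_eval (a : K) (γ : WithTop Λ) (f : K[X]) :
    gaussVal u a γ f ≤ u (f.eval a) := by
  have h := isKey_gauss u a γ
  have := augment_le (μ := fun g => u (g.coeff 0)) (α := γ) h.monic h.pos h.map_zero f 0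
  rw [expCoeff_zero_right, modByMonic_X_sub_C_eq_C_eval] at this
  rw [gaussVal_apply, gauss]
  simpa using this

/-- The value of the `n`-th term of the expansion of `f` at `a`. -/
noncomputable def gaussTerm (a : K) (γ : WithTop Λ) (f : K[X]) (n : ℕ) : WithTop Λ :=
  u ((expCoeff (X - C a) f n).coeff 0) + n • γ

theorem gaussVal_le_term (a : K) (γ : WithTop Λ) (f : K[X]) (n : ℕ) :
    gaussVal u a γ f ≤ gaussTerm u a γ f n := by
  have h := isKey_gauss u a γ
  exact augment_le (μ := fun g => u (g.coeff 0)) h.monic h.pos h.map_zero f n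

theorem exists_gaussVal_eq_term (a : K) (γ : WithTop Λ) (f : K[X]) :
    ∃ n, gaussVal u a γ f = gaussTerm u a γ f n :=
  exists_augment_eq (fun g => u (g.coeff 0)) _ _ _

theorem lt_gaussVal_sub_term {a : K} {γ : WithTop Λ} {f : K[X]} {n : ℕ} {x : WithTop Λ}
    (hx : x < ⊤) (h : ∀ k, k ≠ n → x < gaussTerm u a γ f k) :
    x < gaussVal u a γ (f - expCoeff (X - C a) f n * (X - C a) ^ n) :=
  lt_augment_sub_term (μ := fun g => u (g.coeff 0)) (isKey_gauss u a γ).monic (isKey_gauss u a γ).map_zero hx h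

end Gauss

/-! ### Values of a polynomial along a pseudo-convergent sequence -/

section PseudoSequence

variable {K Λ J : Type*} [Field K] [AddCommGroup Λ] [LinearOrder Λ] [IsOrderedAddMonoid Λ]
  [LinearOrder J] {u : AddValuation K (WithTop Λ)} {b : J → K} {γ : J → WithTop Λ}

/-- `b` is pseudo-convergent with increasing radii `γ`. -/
structure HasRadii (u : AddValuation K (WithTop Λ)) (b : J → K) (γ : J → WithTop Λ) : Prop where
  diff : ∀ i j, i < j → u (b i - b j) = γ i
  strict : StrictMono γ

namespace HasRadii

theorem ne_top [NoMaxOrder J] (h : HasRadii u b γ) (i : J) : γ i ≠ ⊤ := by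
  obtain ⟨j, hj⟩ := exists_gt i
  exact (h.strict hj).ne_top

theorem recenter (h : HasRadii u b γ) {i j : J} (hij : i ≤ j) :
    gaussVal u (b i) (γ i) = gaussVal u (b j) (γ i) := by
  rcases hij.eq_or_lt with rfl | hij
  · rfl
  · exact gaussVal_recenter u (h.diff i j hij).ge

theorem gaussVal_mono (h : HasRadii u b γ) {i j : J} (hij : i ≤ j) (f : K[X]) :
    gaussVal u (b i) (γ i) f ≤ gaussVal u (b j) (γ j) f := by
  rw [h.recenter hij]
  refine gaussVal_le u (fun c => (gaussVal_C u _ c _).ge) ?_ f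
  rw [gaussVal_X_sub_C]
  exact h.strict.monotone hij

theorem nsmul_radius_lt [NoMaxOrder J] (h : HasRadii u b γ) {i j : J} (hij : i < j) {n : ℕ}
    (hn : n ≠ 0) : n • γ i < n • γ j := by
  have h1 := h.strict hij
  have hi := h.ne_top i
  have hj := h.ne_top j
  lift γ i to Λ using hi with x
  lift γ j to Λ using hj with y
  norm_cast at h1 ⊢
  exact nsmul_lt_nsmul_right hn h1

/-- Around `b j`, every finite nonconstant term grows strictly when the radius passes from `γ i` to
`γ j`. If the minimum does not grow, the constant term alone attains it at `γ j`, and it keeps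
dominating afterwards. -/
theorem gaussVal_eq_of_eq [NoMaxOrder J] (h : HasRadii u b γ) {i j k : J} (hij : i < j)
    (hjk : j ≤ k) {f : K[X]} (heq : gaussVal u (b i) (γ i) f = gaussVal u (b j) (γ j) f) :
    gaussVal u (b k) (γ k) f = gaussVal u (b j) (γ j) f := by
  rcases eq_or_ne f 0 with rfl | hf
  · simp
  have hfin : gaussVal u (b j) (γ j) f < ⊤ := by
    rw [lt_top_iff_ne_top, Ne, gaussVal_eq_top_iff u _ (h.ne_top j)]
    exact hf
  set c := f.eval (b j) with hc
  have hlt : gaussVal u (b j) (γ j) f < gaussVal u (b j) (γ j) (f - C c) := by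
    have h1 := lt_gaussVal_sub_term u (a := b j) (γ := γ j) (f := f) (n := 0) hfin ?_
    · rwa [expCoeff_zero_right, modByMonic_X_sub_C_eq_C_eval, pow_zero, mul_one] at h1
    intro n hn
    have h2 := gaussVal_le_term u (b j) (γ i) f n
    rw [← h.recenter hij.le, heq] at h2
    rw [gaussTerm] at h2 ⊢
    by_cases ht : u ((expCoeff (X - C (b j)) f n).coeff 0) = ⊤
    · rwa [ht, top_add]
    · exact h2.trans_lt (WithTop.add_lt_add_left ht (h.nsmul_radius_lt hij hn))
  have huc : u c = gaussVal u (b j) (γ j) f := by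
    rw [← gaussVal_C u (b j) c (γ j), ← AddValuation.map_sub_eq_of_lt_left _ hlt]
    congr 1; ring
  have hlt' : gaussVal u (b k) (γ k) (C c) < gaussVal u (b k) (γ k) (f - C c) := by
    rw [gaussVal_C, huc]
    exact hlt.trans_le (h.gaussVal_mono hjk _)
  have := AddValuation.map_add_eq_of_lt_left _ hlt'
  rwa [add_sub_cancel, gaussVal_C, huc] at this

/-- Since `b i - b j` has value exactly `γ i`, the terms at `b i` have the values entering the
minimum. A larger value of the sum requires a cancellation, hence two minimal terms. -/
theorem exists_two_terms [NoMaxOrder J] (h : HasRadii u b γ) {i j : J} (hij : i < j) {f : K[X]}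
    (hf : f ≠ 0) (hne : u (f.eval (b i)) ≠ gaussVal u (b i) (γ i) f) :
    ∃ m n, m < n ∧ gaussVal u (b i) (γ i) f = gaussTerm u (b j) (γ i) f m ∧
      gaussVal u (b i) (γ i) f = gaussTerm u (b j) (γ i) f n := by
  have hfin : gaussVal u (b i) (γ i) f < ⊤ := by
    rw [lt_top_iff_ne_top, Ne, gaussVal_eq_top_iff u _ (h.ne_top i)]
    exact hf
  have hrec := h.recenter hij.le
  obtain ⟨n, hn⟩ := exists_gaussVal_eq_term u (b j) (γ i) f
  rw [← hrec] at hn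
  by_contra! hcon
  apply hne
  have hlt := lt_gaussVal_sub_term u (a := b j) (γ := γ i) (f := f) (n := n) hfin ?_
  · rw [← hrec] at hlt
    have h1 := hlt.trans_le (gaussVal_le_eval u (b i) (γ i) _)
    have h2 : u ((expCoeff (X - C (b j)) f n * (X - C (b j)) ^ n).eval (b i)) =
        gaussVal u (b i) (γ i) f := by
      have h3 := degree_lt_X_sub_C_iff.1 (degree_expCoeff_lt (monic_X_sub_C (b j)) f n)
      rw [hn, gaussTerm, h3]
      simp [h.diff i j hij]
    have h4 := AddValuation.map_add_eq_of_lt_left u (h2.trans_lt h1)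
    rwa [← eval_add, add_sub_cancel, h2] at h4
  · intro k hk
    have hle := gaussVal_le_term u (b j) (γ i) f k
    rw [← hrec] at hle
    refine lt_of_le_of_ne hle fun heq => ?_
    rcases lt_or_gt_of_ne hk with hk | hk
    · exact hcon k n hk heq hn
    · exact hcon n k hk hn heq

/-- Enlarging the radius penalizes high exponents more than low ones, as for the slopes of a Newton
polygon. -/
theorem argmin_antitone [NoMaxOrder J] (h : HasRadii u b γ) {i i' j : J} (hi : i < i')
    (hj : i' < j) {f : K[X]} (hf : f ≠ 0) {m n : ℕ}
    (hm : gaussVal u (b i) (γ i) f = gaussTerm u (b j) (γ i) f m)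
    (hn : gaussVal u (b i') (γ i') f = gaussTerm u (b j) (γ i') f n) : n ≤ m := by
  by_contra! hlt
  obtain ⟨d, rfl⟩ := Nat.exists_eq_add_of_lt hlt
  have h1 := gaussVal_le_term u (b j) (γ i) f (m + d + 1)
  rw [← h.recenter (hi.trans hj).le, hm] at h1
  have h2 := gaussVal_le_term u (b j) (γ i') f m
  rw [← h.recenter hj.le, hn] at h2
  have hm' : gaussTerm u (b j) (γ i) f m ≠ ⊤ := by
    rw [← hm, Ne, gaussVal_eq_top_iff u _ (h.ne_top i)]; exact hf
  have hn' : gaussTerm u (b j) (γ i') f (m + d + 1) ≠ ⊤ := by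
    rw [← hn, Ne, gaussVal_eq_top_iff u _ (h.ne_top i')]; exact hf
  have hγ := h.strict hi
  have hx := h.ne_top i
  have hy := h.ne_top i'
  rw [gaussTerm] at hm' hn'
  have hA := (WithTop.add_ne_top.1 hm').1
  have hB := (WithTop.add_ne_top.1 hn').1
  rw [gaussTerm, gaussTerm] at h1 h2
  lift u ((expCoeff (X - C (b j)) f m).coeff 0) to Λ using hA with A
  lift u ((expCoeff (X - C (b j)) f (m + d + 1)).coeff 0) to Λ using hB with B
  lift γ i to Λ using hx with x
  lift γ i' to Λ using hy with y
  norm_cast at h1 h2 hγ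
  rw [add_assoc m d 1, add_nsmul] at h1 h2
  have h3 : A ≤ B + (d + 1) • x := by
    rw [add_comm (m • x), ← add_assoc] at h1
    exact le_of_add_le_add_right h1
  have h4 : B + (d + 1) • y ≤ A := by
    rw [add_comm (m • y), ← add_assoc] at h2
    exact le_of_add_le_add_right h2
  exact absurd (le_of_add_le_add_left (h4.trans h3))
    (not_le.2 (nsmul_lt_nsmul_right d.succ_ne_zero hγ))

theorem eventually_eval_eq [NoMaxOrder J] [Nonempty J] (h : HasRadii u b γ) {f : K[X]}
    (hf : f ≠ 0) : ∃ i₀, ∀ i, i₀ ≤ i → u (f.eval (b i)) = gaussVal u (b i) (γ i) f := by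
  by_contra! hbad
  -- Each exceptional index has two minimizing exponents `m < n'`, and all later ones are at most
  -- `m`. So `k` exceptional indices bring the minimizing exponent down to `natDegree f - k`, absurd
  -- for `k = natDegree f + 1`.
  have key : ∀ k : ℕ, ∃ i, ∀ i' j n, i ≤ i' → i' < j →
      gaussVal u (b i') (γ i') f = gaussTerm u (b j) (γ i') f n → n + k ≤ f.natDegree := by
    intro k
    induction k with
    | zero =>
      refine ⟨Classical.arbitrary J, fun i' j n _ _ hn => ?_⟩
      by_contra hlt
      rw [gaussTerm, expCoeff_eq_zero_of_natDegree_lt (monic_X_sub_C _)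
        (natDegree_X_sub_C_pos _) (by omega), coeff_zero, u.map_zero, top_add,
        gaussVal_eq_top_iff u _ (h.ne_top i')] at hn
      exact hf hn
    | succ k ih =>
      obtain ⟨i, hi⟩ := ih
      obtain ⟨i₁, hi₁, hne⟩ := hbad i
      obtain ⟨i₂, hi₂⟩ := exists_gt i₁
      refine ⟨i₂, fun i' j n hi' hj hn => ?_⟩
      obtain ⟨m, n', hmn, hm, hn'⟩ := h.exists_two_terms ((hi₂.trans_le hi').trans hj) hf hne
      have h1 := h.argmin_antitone (hi₂.trans_le hi') hj hf hm hn
      have h2 := hi i₁ j n' hi₁ ((hi₂.trans_le hi').trans hj) hn'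
      omega
  obtain ⟨i, hi⟩ := key (f.natDegree + 1)
  obtain ⟨j, hj⟩ := exists_gt i
  obtain ⟨n, hn⟩ := exists_gaussVal_eq_term u (b j) (γ i) f
  rw [← h.recenter hj.le] at hn
  have := hi i j n le_rfl hj hn
  omega

theorem eval_fixed_iff_isStable [NoMaxOrder J] [Nonempty J] (h : HasRadii u b γ) (f : K[X]) :
    (∃ i₀, ∀ i, i₀ ≤ i → u (f.eval (b i)) = u (f.eval (b i₀))) ↔
      IsStable (fun i => ⇑(gaussVal u (b i) (γ i))) f := by
  rcases eq_or_ne f 0 with rfl | hf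
  · exact ⟨fun _ => ⟨Classical.arbitrary J, by simp⟩, fun _ => ⟨Classical.arbitrary J, by simp⟩⟩
  obtain ⟨i₁, hi₁⟩ := h.eventually_eval_eq hf
  constructor
  · rintro ⟨i₀, hi₀⟩
    refine ⟨max i₀ i₁, fun i hi => ?_⟩
    obtain ⟨ha, hb⟩ := max_le_iff.1 hi
    simp only
    rw [← hi₁ i hb, ← hi₁ _ (le_max_right _ _), hi₀ i ha, hi₀ _ (le_max_left _ _)]
  · rintro ⟨i₀, hi₀⟩
    refine ⟨max i₀ i₁, fun i hi => ?_⟩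
    obtain ⟨ha, hb⟩ := max_le_iff.1 hi
    rw [hi₁ i hb, hi₁ _ (le_max_right _ _)]
    exact (hi₀ i ha).trans (hi₀ _ (le_max_left _ _)).symm

theorem strictMono_of_not_isStable [NoMaxOrder J] (h : HasRadii u b γ) {f : K[X]}
    (hf : ¬ IsStable (fun i => ⇑(gaussVal u (b i) (γ i))) f) :
    StrictMono fun i => gaussVal u (b i) (γ i) f := by
  intro i j hij
  refine lt_of_le_of_ne (h.gaussVal_mono hij.le f) fun heq => hf ⟨j, fun k hk => ?_⟩
  exact h.gaussVal_eq_of_eq hij hk heq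

end HasRadii

end PseudoSequence

/-! ### Equivalence of valuations -/

section Equivalence

variable {K Λ : Type*} [Field K] [AddCommGroup Λ] [LinearOrder Λ] [IsOrderedAddMonoid Λ]
  {μ μ' μ'' : K[X] → WithTop Λ}

theorem mem_valueGroup {f : K[X]} {x : Λ} (h : μ f = (x : WithTop Λ)) : x ∈ valueGroup μ :=
  AddSubgroup.subset_closure ⟨f, h⟩

theorem Equivalent.symm (h : Equivalent μ μ') : Equivalent μ' μ := by
  obtain ⟨τ, hτ⟩ := h
  refine ⟨τ.symm, fun f => ⟨fun hf => ?_, fun x hx => ?_⟩⟩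
  · by_contra hne
    obtain ⟨x, hx⟩ := WithTop.ne_top_iff_exists.1 hne
    have := (hτ f).2 ⟨x, mem_valueGroup hx.symm⟩ hx.symm
    rw [hf] at this
    exact WithTop.top_ne_coe this
  · rcases eq_or_ne (μ f) ⊤ with ht | ht
    · rw [(hτ f).1 ht] at hx
      exact absurd hx WithTop.top_ne_coe
    · obtain ⟨y, hy⟩ := WithTop.ne_top_iff_exists.1 ht
      have h1 := (hτ f).2 ⟨y, mem_valueGroup hy.symm⟩ hy.symm
      rw [hx, WithTop.coe_inj, Subtype.coe_inj] at h1
      rw [h1]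
      exact hy.symm.trans (by simp)

theorem Equivalent.trans (h : Equivalent μ μ') (h' : Equivalent μ' μ'') : Equivalent μ μ'' := by
  obtain ⟨τ, hτ⟩ := h
  obtain ⟨σ, hσ⟩ := h'
  exact ⟨τ.trans σ, fun f => ⟨fun hf => (hσ f).1 ((hτ f).1 hf),
    fun x hx => (hσ f).2 _ ((hτ f).2 x hx)⟩⟩

/-- Both valuations come from the same elements of `M`, on which `φ` and `φ'` induce one order; the
isomorphism is `φ'` after the inverse of `φ`, restricted to the subgroup generated by these
elements. It is applied with `M = Γ × ℤ`. -/
theorem equivalent_of_factor {M : Type*} [AddCommGroup M] (φ φ' : M →+ Λ)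
    (hφ : Function.Injective φ) (hφ' : Function.Injective φ')
    (hle : ∀ x y, φ x ≤ φ y ↔ φ' x ≤ φ' y)
    (h : ∀ f, (μ f = ⊤ ∧ μ' f = ⊤) ∨
      ∃ m, μ f = (φ m : WithTop Λ) ∧ μ' f = (φ' m : WithTop Λ)) : Equivalent μ μ' := by
  have hgrp : ∀ (ψ : M →+ Λ) (κ : K[X] → WithTop Λ)
      (hκ : ∀ f, κ f = ⊤ ∨ ∃ m, κ f = (ψ m : WithTop Λ)),
      valueGroup κ = (AddSubgroup.closure {m | ∃ f, κ f = (ψ m : WithTop Λ)}).map ψ := by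
    intro ψ κ hκ
    rw [AddMonoidHom.map_closure, valueGroup]
    congr 1
    ext x
    constructor
    · rintro ⟨f, hf⟩
      rcases hκ f with h1 | ⟨m, hm⟩
      · rw [h1] at hf
        exact absurd hf WithTop.top_ne_coe
      · refine ⟨m, ⟨f, hm⟩, ?_⟩
        rwa [hm, WithTop.coe_inj] at hf
    · rintro ⟨m, ⟨f, hf⟩, rfl⟩
      exact ⟨f, hf⟩
  have hset : {m | ∃ f, μ f = (φ m : WithTop Λ)} = {m | ∃ f, μ' f = (φ' m : WithTop Λ)} := by
    ext m
    refine exists_congr fun f => ?_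
    rcases h f with ⟨h1, h2⟩ | ⟨m', h1, h2⟩
    · simp [h1, h2]
    · rw [h1, h2, WithTop.coe_inj, WithTop.coe_inj, hφ.eq_iff, hφ'.eq_iff]
  have g1 := hgrp φ μ fun f => (h f).imp And.left fun ⟨m, hm⟩ => ⟨m, hm.1⟩
  have g2 := hgrp φ' μ' fun f => (h f).imp And.right fun ⟨m, hm⟩ => ⟨m, hm.2⟩
  rw [← hset] at g2
  set S := AddSubgroup.closure {m | ∃ f, μ f = (φ m : WithTop Λ)}
  let σ : S ≃+ valueGroup μ :=
    (S.equivMapOfInjective φ hφ).trans (AddEquiv.addSubgroupCongr g1.symm)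
  let σ' : S ≃+ valueGroup μ' :=
    (S.equivMapOfInjective φ' hφ').trans (AddEquiv.addSubgroupCongr g2.symm)
  have hσ : ∀ s : S, (σ s : Λ) = φ s := fun s => rfl
  have hσ' : ∀ s : S, (σ' s : Λ) = φ' s := fun s => rfl
  refine ⟨⟨σ.symm.trans σ', fun {x y} => ?_⟩, fun f => ⟨fun hf => ?_, fun x hx => ?_⟩⟩
  · obtain ⟨s, rfl⟩ := σ.surjective x
    obtain ⟨t, rfl⟩ := σ.surjective y
    change σ' (σ.symm (σ s)) ≤ σ' (σ.symm (σ t)) ↔ _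
    rw [σ.symm_apply_apply, σ.symm_apply_apply, ← Subtype.coe_le_coe, ← Subtype.coe_le_coe, hσ, hσ,
      hσ', hσ', hle]
  · rcases h f with h1 | ⟨m, h1, -⟩
    · exact h1.2
    · rw [h1] at hf
      exact absurd hf WithTop.coe_ne_top
  · obtain ⟨s, rfl⟩ := σ.surjective x
    change μ' f = ((σ' (σ.symm (σ s)) : Λ) : WithTop Λ)
    rw [σ.symm_apply_apply, hσ']
    rw [hσ] at hx
    rcases h f with h1 | ⟨m, h1, h2⟩
    · rw [h1.1] at hx
      exact absurd hx WithTop.top_ne_coe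
    · rw [h1, WithTop.coe_inj, hφ.eq_iff] at hx
      rw [h2, hx]

end Equivalence

/-! ### Ultimate values -/

section Stable

open Filter

variable {K Λ J : Type*} [Field K] [AddCommGroup Λ] [LinearOrder Λ] [IsOrderedAddMonoid Λ]
  [LinearOrder J] [Nonempty J] {ν : J → K[X] → WithTop Λ}

theorem IsStable.eventually_eq {f : K[X]} (h : IsStable ν f) :
    ∀ᶠ i in atTop, ν i f = stableVal ν f := by
  rw [stableVal, dif_pos h]
  filter_upwards [eventually_ge_atTop h.choose] with i hi using h.choose_spec i hi

theorem isStable_of_eventually {f : K[X]} {c : WithTop Λ} (h : ∀ᶠ i in atTop, ν i f = c) :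
    IsStable ν f := by
  obtain ⟨i₀, hi₀⟩ := eventually_atTop.1 h
  exact ⟨i₀, fun i hi => (hi₀ i hi).trans (hi₀ i₀ le_rfl).symm⟩

theorem stableVal_eq_of_eventually {f : K[X]} {c : WithTop Λ} (h : ∀ᶠ i in atTop, ν i f = c) :
    stableVal ν f = c := by
  obtain ⟨i, h1, h2⟩ := ((isStable_of_eventually h).eventually_eq.and h).exists
  exact h1.symm.trans h2

end Stable

/-! ### Limit augmentations of an increasing family -/

section Family

open Filter

variable {K Γ Λ J : Type*} [Field K]
  [AddCommGroup Γ] [LinearOrder Γ] [IsOrderedAddMonoid Γ]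
  [AddCommGroup Λ] [LinearOrder Λ] [IsOrderedAddMonoid Λ]
  [LinearOrder J] [Nonempty J] [NoMaxOrder J]
  {v : AddValuation K (WithTop Γ)} {e : Γ →+ Λ} {ν : J → K[X] → WithTop Λ} {F G : K[X]} {γ γ' : Λ}

/-- An increasing family of valuations extending `v`, with values in `e Γ`, in which the values of
an unstable polynomial are strictly increasing. -/
structure IsIncreasing (v : AddValuation K (WithTop Γ)) (e : Γ →+ Λ) (ν : J → K[X] → WithTop Λ) :
    Prop where
  val : ∀ i, ∃ w : AddValuation K[X] (WithTop Λ), ∀ f, w f = ν i f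
  ext : ∀ i c, ν i (C c) = (v c).map e
  range : ∀ i f, f ≠ 0 → ∃ g : Γ, ν i f = (e g : WithTop Λ)
  mono : Monotone ν
  strict : ∀ f, ¬ IsStable ν f → StrictMono fun i => ν i f

/-- `F` is a monic unstable polynomial of least degree. -/
structure IsMinUnstable (ν : J → K[X] → WithTop Λ) (F : K[X]) : Prop where
  monic : F.Monic
  unstable : ¬ IsStable ν F
  least : ∀ g, ¬ IsStable ν g → F.natDegree ≤ g.natDegree

/-- `γ` lies above the values of `F` and below the elements of the divisible closure that are
above all these values. -/
structure InCut (e : Γ →+ Λ) (ν : J → K[X] → WithTop Λ) (F : K[X]) (γ : Λ) : Prop where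
  below : ∀ i, ν i F < (γ : WithTop Λ)
  above : ∀ x ∈ divClosure e, (∀ i, ν i F < (x : WithTop Λ)) → γ < x

theorem InCut.notMem (h : InCut e ν F γ) : γ ∉ divClosure e := fun hγ =>
  lt_irrefl γ (h.above γ hγ h.below)

theorem map_mem_divClosure (e : Γ →+ Λ) (g : Γ) : e g ∈ divClosure e :=
  ⟨1, one_pos, by simp⟩

namespace IsIncreasing

theorem map_zero (hν : IsIncreasing v e ν) (i : J) : ν i 0 = ⊤ := by
  obtain ⟨w, hw⟩ := hν.val i
  rw [← hw, w.map_zero]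

theorem stable_C (hν : IsIncreasing v e ν) (c : K) : IsStable ν (C c) :=
  ⟨Classical.arbitrary J, fun i _ => by rw [hν.ext, hν.ext]⟩

theorem stableVal_C (hν : IsIncreasing v e ν) (c : K) : stableVal ν (C c) = (v c).map e :=
  stableVal_eq_of_eventually (Eventually.of_forall fun i => hν.ext i c)

theorem stableVal_zero (hν : IsIncreasing v e ν) : stableVal ν 0 = ⊤ :=
  stableVal_eq_of_eventually (Eventually.of_forall fun i => hν.map_zero i)

theorem stableVal_one (hν : IsIncreasing v e ν) : stableVal ν 1 = 0 := by
  refine stableVal_eq_of_eventually (Eventually.of_forall fun i => ?_)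
  obtain ⟨w, hw⟩ := hν.val i
  rw [← hw, w.map_one]

theorem pos (hν : IsIncreasing v e ν) (hF : IsMinUnstable ν F) : 0 < F.natDegree := by
  rw [Nat.pos_iff_ne_zero]
  intro h
  apply hF.unstable
  rw [eq_C_of_natDegree_eq_zero h]
  exact hν.stable_C _

theorem stable (hν : IsIncreasing v e ν) (hF : IsMinUnstable ν F) {f : K[X]}
    (hf : f.degree < F.degree) : IsStable ν f := by
  rcases eq_or_ne f 0 with rfl | hf0
  · rw [← C_0]
    exact hν.stable_C 0
  · by_contra h
    exact absurd (natDegree_lt_natDegree hf0 hf) (not_lt.2 (hF.least f h))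

theorem stableVal_range (hν : IsIncreasing v e ν) {f : K[X]} (hf : IsStable ν f) (hf0 : f ≠ 0) :
    ∃ g : Γ, stableVal ν f = (e g : WithTop Λ) := by
  obtain ⟨i, hi⟩ := hf.eventually_eq.exists
  obtain ⟨g, hg⟩ := hν.range i f hf0
  exact ⟨g, hi.symm.trans hg⟩

theorem exists_values (hν : IsIncreasing v e ν) (hF : IsMinUnstable ν F) :
    ∃ y : J → Γ, (∀ i, ν i F = (e (y i) : WithTop Λ)) ∧ StrictMono fun i => e (y i) := by
  have hF0 : F ≠ 0 := hF.monic.ne_zero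
  choose y hy using fun i => hν.range i F hF0
  refine ⟨y, hy, fun i j hij => ?_⟩
  have := hν.strict F hF.unstable hij
  simpa [hy] using this

/-- A `γ` in the divisible closure would lie in both halves of its quasi-cut, whereas the halves of
`cutOf` are disjoint. The values of `F` have no largest one, so all inequalities are strict. -/
theorem inCut_of_quasiCut_eq (hν : IsIncreasing v e ν) (hF : IsMinUnstable ν F)
    (h : quasiCut (divClosure e) γ = cutOf (divClosure e) ν F) : InCut e ν F γ := by
  obtain ⟨y, hy, hmono⟩ := hν.exists_values hF
  have h1 := congrArg Prod.fst h
  have h2 := congrArg Prod.snd h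
  simp only [quasiCut, cutOf] at h1 h2
  refine ⟨fun i => ?_, fun x hx hlt => ?_⟩
  · obtain ⟨j, hj⟩ := exists_gt i
    have h3 : e (y j) ∈ {x ∈ divClosure e | x ≤ γ} := by
      rw [h1]; exact ⟨map_mem_divClosure e _, j, (hy j).ge⟩
    rw [hy, WithTop.coe_lt_coe]
    exact (hmono hj).trans_le h3.2
  · have hno : ¬ ∃ i, (x : WithTop Λ) ≤ ν i F := by
      rintro ⟨i, hi⟩
      exact absurd (hlt i) (not_lt.2 hi)
    have h3 : x ∈ {x ∈ divClosure e | γ ≤ x} := by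
      rw [h2]; exact ⟨hx, hno⟩
    refine lt_of_le_of_ne h3.2 ?_
    rintro rfl
    have h4 : γ ∈ {x ∈ divClosure e | x ≤ γ} := ⟨hx, le_rfl⟩
    rw [h1] at h4
    exact hno h4.2

theorem quasiCut_eq_of_inCut (h : InCut e ν F γ) :
    quasiCut (divClosure e) γ = cutOf (divClosure e) ν F := by
  have hl : ∀ x ∈ divClosure e, x ≤ γ ↔ ∃ i, (x : WithTop Λ) ≤ ν i F := by
    intro x hx
    constructor
    · intro hle
      by_contra! hno
      exact absurd (h.above x hx hno) (not_lt.2 hle)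
    · rintro ⟨i, hi⟩
      exact (WithTop.coe_lt_coe.1 (hi.trans_lt (h.below i))).le
  refine Prod.ext ?_ ?_
  · ext x
    exact and_congr_right fun hx => hl x hx
  · ext x
    refine and_congr_right fun hx => ?_
    rw [← hl x hx, not_le]
    refine ⟨fun hle => lt_of_le_of_ne hle ?_, le_of_lt⟩
    rintro rfl
    exact h.notMem hx

/-- The elements `e g + n γ` are ordered as the elements `e g + n ν_i(F)` for `i` large. -/
theorem lt_or_lt (hdiv : ∀ n : ℕ, n ≠ 0 → ∀ x : Λ, ∃ z, n • z = x) {y : J → Λ}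
    (hy : ∀ i, ν i F = (y i : WithTop Λ)) (hmono : StrictMono y) (g g' : Γ) {n n' : ℕ}
    (hn : n < n') :
    ((∀ γ, InCut e ν F γ → e g + n • γ < e g' + n' • γ) ∧
      ∀ᶠ i in atTop, e g + n • y i < e g' + n' • y i) ∨
    ((∀ γ, InCut e ν F γ → e g' + n' • γ < e g + n • γ) ∧
      ∀ᶠ i in atTop, e g' + n' • y i < e g + n • y i) := by
  obtain ⟨d, rfl⟩ := Nat.exists_eq_add_of_lt hn
  -- `z` is the crossing point of `t ↦ e g + n • t` and `t ↦ e g' + n' • t`, where `n' - n = d + 1`.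
  obtain ⟨z, hz⟩ := hdiv (d + 1) d.succ_ne_zero (e g - e g')
  have hzD : z ∈ divClosure e := ⟨d + 1, d.succ_pos, g - g', by rw [hz, map_sub]⟩
  have h1 : ∀ t, z < t → e g + n • t < e g' + (n + d + 1) • t := by
    intro t ht
    have h3 : (d + 1) • z < (d + 1) • t := nsmul_lt_nsmul_right d.succ_ne_zero ht
    rw [hz, sub_lt_iff_lt_add'] at h3
    rw [add_assoc n, add_nsmul, add_comm (n • t), ← add_assoc]
    exact add_lt_add_left h3 _
  have h2 : ∀ t, t < z → e g' + (n + d + 1) • t < e g + n • t := by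
    intro t ht
    have h3 : (d + 1) • t < (d + 1) • z := nsmul_lt_nsmul_right d.succ_ne_zero ht
    rw [hz, lt_sub_iff_add_lt'] at h3
    rw [add_assoc n, add_nsmul, add_comm (n • t), ← add_assoc]
    exact add_lt_add_left h3 _
  by_cases hex : ∃ i, z ≤ y i
  · obtain ⟨i, hi⟩ := hex
    refine Or.inl ⟨fun γ hγ => h1 γ (hi.trans_lt ?_), ?_⟩
    · have := hγ.below i
      rwa [hy, WithTop.coe_lt_coe] at this
    · filter_upwards [eventually_gt_atTop i] with j hj
      exact h1 _ (hi.trans_lt (hmono hj))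
  · push Not at hex
    refine Or.inr ⟨fun γ hγ => h2 γ (hγ.above z hzD fun i => ?_), Eventually.of_forall fun i => ?_⟩
    · rw [hy, WithTop.coe_lt_coe]
      exact hex i
    · exact h2 _ (hex i)

theorem eventually_lt (hdiv : ∀ n : ℕ, n ≠ 0 → ∀ x : Λ, ∃ z, n • z = x) {y : J → Λ}
    (hy : ∀ i, ν i F = (y i : WithTop Λ)) (hmono : StrictMono y) (hγ : InCut e ν F γ) {g g' : Γ}
    {n n' : ℕ} (hn : n ≠ n') (h : e g + n • γ ≤ e g' + n' • γ) :
    ∀ᶠ i in atTop, e g + n • y i < e g' + n' • y i := by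
  rcases lt_or_gt_of_ne hn with hn | hn
  · rcases lt_or_lt (e := e) hdiv hy hmono g g' hn with h1 | h1
    · exact h1.2
    · exact absurd h (not_le.2 (h1.1 γ hγ))
  · rcases lt_or_lt (e := e) hdiv hy hmono g' g hn with h1 | h1
    · exact absurd h (not_le.2 (h1.1 γ hγ))
    · exact h1.2

theorem le_iff_le (hdiv : ∀ n : ℕ, n ≠ 0 → ∀ x : Λ, ∃ z, n • z = x) (hν : IsIncreasing v e ν)
    (hF : IsMinUnstable ν F) (hγ : InCut e ν F γ) (hγ' : InCut e ν F γ') (g g' : Γ) (n n' : ℕ) :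
    e g + n • γ ≤ e g' + n' • γ ↔ e g + n • γ' ≤ e g' + n' • γ' := by
  obtain ⟨y, hy, hmono⟩ := hν.exists_values hF
  rcases lt_trichotomy n n' with hn | rfl | hn
  · rcases lt_or_lt (e := e) hdiv hy hmono g g' hn with h1 | h1
    · exact iff_of_true (h1.1 γ hγ).le (h1.1 γ' hγ').le
    · exact iff_of_false (not_le.2 (h1.1 γ hγ)) (not_le.2 (h1.1 γ' hγ'))
  · simp
  · rcases lt_or_lt (e := e) hdiv hy hmono g' g hn with h1 | h1
    · exact iff_of_false (not_le.2 (h1.1 γ hγ)) (not_le.2 (h1.1 γ' hγ'))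
    · exact iff_of_true (h1.1 γ hγ).le (h1.1 γ' hγ').le

/-- No nonzero multiple of `γ` lies in the image of `Γ`: an equality with distinct exponents would
give both strict inequalities for large `i`. -/
theorem index_eq (hdiv : ∀ n : ℕ, n ≠ 0 → ∀ x : Λ, ∃ z, n • z = x) (hν : IsIncreasing v e ν)
    (hF : IsMinUnstable ν F) (hγ : InCut e ν F γ) {g g' : Γ} {n n' : ℕ}
    (h : e g + n • γ = e g' + n' • γ) : n = n' := by
  obtain ⟨y, hy, hmono⟩ := hν.exists_values hF
  by_contra hn
  obtain ⟨i, h1, h2⟩ := ((eventually_lt hdiv hy hmono hγ hn h.le).and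
    (eventually_lt hdiv hy hmono hγ (Ne.symm hn) h.ge)).exists
  exact lt_asymm h1 h2

theorem augment_eq_top_iff (hν : IsIncreasing v e ν) (hF : IsMinUnstable ν F) (γ : Λ) (f : K[X]) :
    augment (stableVal ν) F γ f = ⊤ ↔ f = 0 := by
  constructor
  · intro h
    by_contra hf
    obtain ⟨n, hn⟩ := exists_expCoeff_ne_zero hF.monic (hν.pos hF) hf
    have h1 := augment_le (α := (γ : WithTop Λ)) hF.monic (hν.pos hF) hν.stableVal_zero f n
    obtain ⟨g, hg⟩ := hν.stableVal_range (hν.stable hF (degree_expCoeff_lt hF.monic f n)) hn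
    rw [h, hg, top_le_iff] at h1
    exact WithTop.coe_ne_top (a := e g + n • γ) h1
  · rintro rfl
    rw [augment_of_degree_lt hF.monic (hν.pos hF) hν.stableVal_zero, hν.stableVal_zero]
    rw [degree_zero, bot_lt_iff_ne_bot, Ne, degree_eq_bot]
    exact hF.monic.ne_zero

/-- Distinct exponents give distinct values at `γ`, so one term is strictly smallest, and it remains
so with `ν i F` in place of `γ` for large `i`. There are finitely many terms, so a common `i`
exists, and there the smallest term determines `ν i f`. -/
theorem exists_leading_term (hdiv : ∀ n : ℕ, n ≠ 0 → ∀ x : Λ, ∃ z, n • z = x)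
    (hν : IsIncreasing v e ν) (hF : IsMinUnstable ν F) (hγ : InCut e ν F γ) {f : K[X]}
    (hf : f ≠ 0) : ∃ (g : Γ) (n : ℕ), expCoeff F f n ≠ 0 ∧
      stableVal ν (expCoeff F f n) = (e g : WithTop Λ) ∧
      augment (stableVal ν) F γ f = ((e g + n • γ : Λ) : WithTop Λ) ∧
      ∀ᶠ i in atTop, ν i f = (e g : WithTop Λ) + n • ν i F := by
  obtain ⟨y, hy, hmono⟩ := hν.exists_values hF
  obtain ⟨n, hn⟩ := exists_augment_eq (stableVal ν) F (γ : WithTop Λ) f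
  have hlo := degree_expCoeff_lt hF.monic f
  have hst := fun k => hν.stable hF (hlo k)
  have hn0 : expCoeff F f n ≠ 0 := by
    intro h0
    rw [h0, hν.stableVal_zero, top_add, hν.augment_eq_top_iff hF] at hn
    exact hf hn
  obtain ⟨g, hg⟩ := hν.stableVal_range (hst n) hn0
  rw [hg] at hn
  refine ⟨g, n, hn0, hg, hn, ?_⟩
  have hterm : ∀ k, ∀ᶠ i in atTop,
      ν i (expCoeff F f k * F ^ k) = stableVal ν (expCoeff F f k) + k • ν i F := by
    intro k
    filter_upwards [(hst k).eventually_eq] with i hi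
    obtain ⟨w, hw⟩ := hν.val i
    rw [← hi, ← hw, ← hw, ← hw, w.map_mul, w.map_pow]
  have hlt : ∀ k, k ≠ n → ∀ᶠ i in atTop,
      (e g : WithTop Λ) + n • ν i F < ν i (expCoeff F f k * F ^ k) := by
    intro k hk
    rcases eq_or_ne (expCoeff F f k) 0 with h0 | h0
    · refine Eventually.of_forall fun i => ?_
      rw [h0, zero_mul, hν.map_zero, hy]
      exact WithTop.coe_lt_top (e g + n • e (y i))
    · obtain ⟨g', hg'⟩ := hν.stableVal_range (hst k) h0
      have hle : e g + n • γ ≤ e g' + k • γ := by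
        have := augment_le (α := (γ : WithTop Λ)) hF.monic (hν.pos hF) hν.stableVal_zero f k
        rw [hn, hg'] at this
        exact_mod_cast this
      filter_upwards [hterm k, eventually_lt hdiv hy hmono hγ (Ne.symm hk) hle] with i h1 h2
      rw [h1, hg', hy]
      exact_mod_cast h2
  have hall : ∀ᶠ i in atTop, ∀ k ∈ (Finset.range (f.natDegree + 1)).erase n,
      (e g : WithTop Λ) + n • ν i F < ν i (expCoeff F f k * F ^ k) := by
    rw [Finset.eventually_all]
    exact fun k hk => hlt k (Finset.ne_of_mem_erase hk)
  have hmem : n ∈ Finset.range (f.natDegree + 1) := by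
    by_contra hmem
    rw [Finset.mem_range, not_lt] at hmem
    exact hn0 (expCoeff_eq_zero_of_natDegree_lt hF.monic (hν.pos hF) hmem)
  filter_upwards [hall, hterm n] with i h1 h2
  obtain ⟨w, hw⟩ := hν.val i
  simp only [← hw] at h1 h2 ⊢
  rw [hg] at h2
  have h3 : (e g : WithTop Λ) + n • w F ≠ ⊤ := by
    rw [hw, hy]
    exact WithTop.coe_ne_top (a := e g + n • e (y i))
  have h4 := w.map_lt_sum h3 h1
  rw [← h2] at h4
  have h5 := w.map_add_eq_of_lt_left h4
  rwa [Finset.add_sum_erase _ (fun k => expCoeff F f k * F ^ k) hmem,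
    sum_expCoeff hF.monic (hν.pos hF) f (Nat.lt_succ_self _), h2] at h5

/-- For reduced nonzero `f` and `g`, `ν i (f * g)` is ultimately constant. The leading exponent is
then `0`, which means that the remainder carries the value and the quotient term is larger. -/
theorem isKey (hdiv : ∀ n : ℕ, n ≠ 0 → ∀ x : Λ, ∃ z, n • z = x)
    (hν : IsIncreasing v e ν) (hF : IsMinUnstable ν F) (hγ : InCut e ν F γ) {α : WithTop Λ}
    (hα : (γ : WithTop Λ) ≤ α) : IsKey (stableVal ν) F α := by
  have hprod : ∀ f g : K[X], f.degree < F.degree → g.degree < F.degree →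
      ∀ᶠ i in atTop, ν i (f * g) = stableVal ν f + stableVal ν g := by
    intro f g hf hg
    filter_upwards [(hν.stable hF hf).eventually_eq, (hν.stable hF hg).eventually_eq] with i h1 h2
    obtain ⟨w, hw⟩ := hν.val i
    rw [← h1, ← h2, ← hw, ← hw, ← hw, w.map_mul]
  have hkey : ∀ f g : K[X], f.degree < F.degree → g.degree < F.degree → f ≠ 0 → g ≠ 0 →
      ∃ g₀ : Γ, stableVal ν f + stableVal ν g = (e g₀ : WithTop Λ) ∧
        stableVal ν (f * g %ₘ F) = (e g₀ : WithTop Λ) ∧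
        augment (stableVal ν) F γ (f * g) = (e g₀ : WithTop Λ) := by
    intro f g hf hg hf0 hg0
    obtain ⟨g₀, n, -, hg₀, haug, hev⟩ :=
      hν.exists_leading_term hdiv hF hγ (mul_ne_zero hf0 hg0)
    -- With `n > 0` the leading term would grow with `ν i F`, against the constancy of the product.
    have hn : n = 0 := by
      by_contra hn
      obtain ⟨y, hy, hmono⟩ := hν.exists_values hF
      obtain ⟨i, hi⟩ := eventually_atTop.1 (hev.and (hprod f g hf hg))
      obtain ⟨j, hj⟩ := exists_gt i
      have h1 := hi i le_rfl
      have h2 := hi j hj.le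
      rw [h1.2, hy] at h1
      rw [h2.2, h1.1, hy] at h2
      have h3 : e g₀ + n • e (y i) = e g₀ + n • e (y j) := by exact_mod_cast h2.1
      exact (nsmul_lt_nsmul_right hn (hmono hj)).ne (add_left_cancel h3)
    subst hn
    obtain ⟨i, h1, h2⟩ := (hev.and (hprod f g hf hg)).exists
    refine ⟨g₀, ?_, hg₀, by simpa using haug⟩
    rw [← h2, h1, zero_nsmul, add_zero]
  constructor
  · exact hF.monic
  · exact hν.pos hF
  · exact hν.stableVal_zero
  · exact hν.stableVal_one
  · intro f hf hf0
    obtain ⟨g, hg⟩ := hν.stableVal_range (hν.stable hF hf) hf0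
    rw [hg]
    exact WithTop.coe_ne_top
  · intro f g hf hg
    have hfg : (f + g).degree < F.degree := (degree_add_le _ _).trans_lt (max_lt hf hg)
    obtain ⟨i, h1, h2, h3⟩ := ((hν.stable hF hf).eventually_eq.and
      ((hν.stable hF hg).eventually_eq.and (hν.stable hF hfg).eventually_eq)).exists
    obtain ⟨w, hw⟩ := hν.val i
    rw [← h1, ← h2, ← h3, ← hw, ← hw, ← hw]
    exact w.map_add f g
  · intro f g hf hg
    rcases eq_or_ne f 0 with rfl | hf0
    · simp [hν.stableVal_zero]
    rcases eq_or_ne g 0 with rfl | hg0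
    · simp [hν.stableVal_zero]
    obtain ⟨g₀, h1, h2, -⟩ := hkey f g hf hg hf0 hg0
    rw [h1, h2]
  · intro f g hf hg hf0 hg0
    obtain ⟨g₀, h1, -, h3⟩ := hkey f g hf hg hf0 hg0
    rw [h1]
    -- Increasing `α` only helps, so `α = γ` is enough; there equality would identify the exponents
    -- `0` and `1`.
    refine lt_of_lt_of_le ?_ (add_le_add le_rfl hα)
    have hdeg := degree_mul_divByMonic_lt hF.monic hf hg
    rcases eq_or_ne (f * g /ₘ F) 0 with h0 | h0
    · rw [h0, hν.stableVal_zero, top_add]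
      exact WithTop.coe_lt_top _
    obtain ⟨g₁, hg₁⟩ := hν.stableVal_range (hν.stable hF hdeg) h0
    have h4 := augment_le (α := (γ : WithTop Λ)) hF.monic (hν.pos hF) hν.stableVal_zero (f * g) 1
    rw [h3, expCoeff_succ, expCoeff_zero_right, (modByMonic_eq_self_iff hF.monic).2 hdeg, hg₁,
      one_nsmul] at h4
    rw [hg₁]
    refine lt_of_le_of_ne h4 fun heq => ?_
    have h5 : e g₀ + 0 • γ = e g₁ + 1 • γ := by
      rw [zero_nsmul, add_zero, one_nsmul]; exact_mod_cast heq
    exact absurd (hν.index_eq hdiv hF hγ h5) zero_ne_one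

theorem le_augment (hdiv : ∀ n : ℕ, n ≠ 0 → ∀ x : Λ, ∃ z, n • z = x)
    (hν : IsIncreasing v e ν) (hF : IsMinUnstable ν F) (hγ : InCut e ν F γ) {α : WithTop Λ}
    (hα : (γ : WithTop Λ) ≤ α) (i : J) : ν i ≤ augment (stableVal ν) F α := by
  intro f
  refine le_trans ?_ (augment_mono hF.monic (fun _ _ => le_rfl) hα f)
  rcases eq_or_ne f 0 with rfl | hf
  · rw [(hν.augment_eq_top_iff hF γ 0).2 rfl]
    exact le_top
  obtain ⟨g, n, -, -, haug, hev⟩ := hν.exists_leading_term hdiv hF hγ hf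
  obtain ⟨j, h1, h2⟩ := (hev.and (eventually_ge_atTop i)).exists
  refine (hν.mono h2 f).trans ?_
  rw [h1, haug, WithTop.coe_add]
  exact add_le_add le_rfl (nsmul_le_nsmul_right (hγ.below j).le n)

theorem augment_mem (hdiv : ∀ n : ℕ, n ≠ 0 → ∀ x : Λ, ∃ z, n • z = x)
    (hν : IsIncreasing v e ν) (hF : IsMinUnstable ν F) (hγ : InCut e ν F γ) {D : Set Λ}
    (hD : ∀ x ∈ D, ∀ (g : Γ) (n : ℕ), e g + n • x ∈ D) (hγD : γ ∈ D) {α : WithTop Λ}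
    (hαD : α = ⊤ ∨ ∃ x ∈ D, α = (x : WithTop Λ)) (hα : (γ : WithTop Λ) ≤ α) :
    augment (stableVal ν) F α ∈ extVals v e D := by
  have hk := hν.isKey hdiv hF hγ hα
  refine ⟨⟨hk.valuation, hk.valuation_apply⟩, fun c => ?_, fun f => ?_⟩
  · rw [augment_of_degree_lt hk.monic hk.pos hk.map_zero, hν.stableVal_C]
    exact degree_C_le.trans_lt (natDegree_pos_iff_degree_pos.1 hk.pos)
  · obtain ⟨n, hn⟩ := exists_augment_eq (stableVal ν) F α f
    rw [hn]
    rcases eq_or_ne (expCoeff F f n) 0 with h0 | h0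
    · rw [h0, hν.stableVal_zero, top_add]
      exact Or.inl rfl
    obtain ⟨g, hg⟩ := hν.stableVal_range (hν.stable hF (degree_expCoeff_lt hF.monic f n)) h0
    rw [hg]
    rcases hαD with rfl | ⟨x, hx, rfl⟩
    · cases n with
      -- `D` need not be a group: `e g` is reached as `e g + 0 • γ`.
      | zero => exact Or.inr ⟨e g + 0 • γ, hD γ hγD g 0, by simp⟩
      | succ n => exact Or.inl (by simp [succ_nsmul])
    · exact Or.inr ⟨_, hD x hx g n, rfl⟩

theorem augment_self (hν : IsIncreasing v e ν) (hF : IsMinUnstable ν F) (α : WithTop Λ) :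
    augment (stableVal ν) F α F = α :=
  PseudoCauchy.augment_self hF.monic (hν.pos hF) hν.stableVal_zero hν.stableVal_one

theorem stableVal_le_of_upper (hν : IsIncreasing v e ν) (hF : IsMinUnstable ν F)
    {μ' : K[X] → WithTop Λ} (hμ' : ∀ i, ν i ≤ μ') {f : K[X]} (hf : f.degree < F.degree) :
    stableVal ν f ≤ μ' f := by
  obtain ⟨i, hi⟩ := (hν.stable hF hf).eventually_eq.exists
  rw [← hi]
  exact hμ' i f

theorem augment_le_of_upper (hν : IsIncreasing v e ν) (hF : IsMinUnstable ν F) {D : Set Λ}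
    {μ' : K[X] → WithTop Λ} (hV : μ' ∈ extVals v e D) (hμ' : ∀ i, ν i ≤ μ') {α : WithTop Λ}
    (hα : α ≤ μ' F) : augment (stableVal ν) F α ≤ μ' := by
  obtain ⟨⟨w, hw⟩, -, -⟩ := hV
  intro f
  rw [← hw]
  refine augment_le_valuation hF.monic (hν.pos hF) w (fun g hg => ?_) (by rwa [hw]) f
  rw [hw]
  exact hν.stableVal_le_of_upper hF hμ' hg

/-- `μ' F` exceeds every `ν i F` because these increase strictly, and being at most `γ` it stays
below the right half of the cut. -/
theorem exists_inCut_of_upper (hν : IsIncreasing v e ν) (hF : IsMinUnstable ν F)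
    (hγ : InCut e ν F γ) {D : Set Λ} {μ' : K[X] → WithTop Λ} (hV : μ' ∈ extVals v e D)
    (hμ' : ∀ i, ν i ≤ μ') (hle : μ' F ≤ (γ : WithTop Λ)) :
    ∃ γ' ∈ D, μ' F = (γ' : WithTop Λ) ∧ InCut e ν F γ' := by
  rcases hV.2.2 F with h | ⟨γ', hγ', h⟩
  · rw [h, top_le_iff] at hle
    exact absurd hle WithTop.coe_ne_top
  · refine ⟨γ', hγ', h, fun i => ?_, fun x hx hlt => ?_⟩
    · obtain ⟨j, hj⟩ := exists_gt i
      rw [← h]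
      exact (hν.strict F hF.unstable hj).trans_le (hμ' j F)
    · rw [h, WithTop.coe_le_coe] at hle
      exact hle.trans_lt (hγ.above x hx hlt)

theorem equivalent_augment (hdiv : ∀ n : ℕ, n ≠ 0 → ∀ x : Λ, ∃ z, n • z = x)
    (he : Function.Injective e) (hν : IsIncreasing v e ν) (hF : IsMinUnstable ν F)
    (hγ : InCut e ν F γ) (hγ' : InCut e ν F γ') :
    Equivalent (augment (stableVal ν) F γ) (augment (stableVal ν) F γ') := by
  -- The formal value `(g, k)` is read as `e g + k • t`. Negative `k` are removed by writing `k` as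
  -- a difference of natural numbers, to which `le_iff_le` applies.
  let φ : Λ → Γ × ℤ →+ Λ := fun t => e.coprod (zmultiplesHom Λ t)
  have hφ : ∀ t g (k : ℤ), φ t (g, k) = e g + k • t := fun t g k => rfl
  have hnonneg : ∀ x, 0 ≤ φ γ x ↔ 0 ≤ φ γ' x := by
    rintro ⟨g, k⟩
    have hk : k = (k.toNat : ℤ) - (-k).toNat := by omega
    rw [hφ, hφ]
    have hr : ∀ t : Λ, e g + k • t = (e g + k.toNat • t) - (e 0 + (-k).toNat • t) := by
      intro t
      conv_lhs => rw [hk, sub_zsmul, natCast_zsmul, natCast_zsmul]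
      rw [_root_.map_zero]
      abel
    rw [hr, hr, sub_nonneg, sub_nonneg]
    exact hν.le_iff_le hdiv hF hγ hγ' _ _ _ _
  have hinj : ∀ t, InCut e ν F t → Function.Injective (φ t) := by
    intro t ht
    rw [injective_iff_map_eq_zero]
    rintro ⟨g, k⟩ h0
    have hk : k = (k.toNat : ℤ) - (-k).toNat := by omega
    rw [hφ] at h0
    have hr : e g + k.toNat • t = e 0 + (-k).toNat • t := by
      rw [hk, sub_zsmul, natCast_zsmul, natCast_zsmul] at h0
      rw [_root_.map_zero, zero_add, ← sub_eq_zero, ← h0]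
      abel
    have h1 := hν.index_eq hdiv hF ht hr
    have hk0 : k = 0 := by omega
    subst hk0
    rw [zero_smul, add_zero, map_eq_zero_iff e he] at h0
    rw [h0]; rfl
  refine equivalent_of_factor (φ γ) (φ γ') (hinj γ hγ) (hinj γ' hγ') (fun x y => ?_) fun f => ?_
  · rw [← sub_nonneg, ← map_sub, hnonneg, map_sub, sub_nonneg]
  · rcases eq_or_ne f 0 with rfl | hf
    · exact Or.inl ⟨(hν.augment_eq_top_iff hF _ _).2 rfl, (hν.augment_eq_top_iff hF _ _).2 rfl⟩
    obtain ⟨g, n, hn0, hg, haug, -⟩ := hν.exists_leading_term hdiv hF hγ hf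
    refine Or.inr ⟨(g, n), by rw [haug, hφ, natCast_zsmul], ?_⟩
    obtain ⟨g', n', hn0', hg', haug', -⟩ := hν.exists_leading_term hdiv hF hγ' hf
    rw [hφ, natCast_zsmul]
    -- The leading terms at `γ` and `γ'` are a priori different. Minimality at `γ`, transported to
    -- `γ'`, shows that the term `(g, n)` is minimal there too.
    have h1 := augment_le (α := (γ : WithTop Λ)) hF.monic (hν.pos hF) hν.stableVal_zero f n'
    have h2 := augment_le (α := (γ' : WithTop Λ)) hF.monic (hν.pos hF) hν.stableVal_zero f n
    rw [haug, hg'] at h1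
    rw [hg] at h2
    refine le_antisymm h2 ?_
    rw [haug', WithTop.coe_le_coe, hν.le_iff_le hdiv hF hγ' hγ]
    exact_mod_cast h1

theorem isSup_augment (hdiv : ∀ n : ℕ, n ≠ 0 → ∀ x : Λ, ∃ z, n • z = x)
    (he : Function.Injective e) (hν : IsIncreasing v e ν) (hF : IsMinUnstable ν F)
    (hγ : InCut e ν F γ) {D : Set Λ} (hD : ∀ x ∈ D, ∀ (g : Γ) (n : ℕ), e g + n • x ∈ D)
    (hγD : γ ∈ D) : IsSup (extVals v e D) ν (augment (stableVal ν) F γ) where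
  mem := hν.augment_mem hdiv hF hγ hD hγD (Or.inr ⟨γ, hγD, rfl⟩) le_rfl
  upper := hν.le_augment hdiv hF hγ le_rfl
  least μ' hV hμ' := by
    -- If `μ' F` falls short of `γ`, it realizes the same cut and replaces `γ`.
    rcases le_total (γ : WithTop Λ) (μ' F) with hle | hle
    · exact ⟨_, hν.augment_mem hdiv hF hγ hD hγD (Or.inr ⟨γ, hγD, rfl⟩) le_rfl,
        hν.equivalent_augment hdiv he hF hγ hγ, hν.augment_le_of_upper hF hV hμ' hle⟩
    · obtain ⟨γ', hγ'D, h, hγ'⟩ := hν.exists_inCut_of_upper hF hγ hV hμ' hle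
      exact ⟨_, hν.augment_mem hdiv hF hγ' hD hγ'D (Or.inr ⟨γ', hγ'D, rfl⟩) le_rfl,
        hν.equivalent_augment hdiv he hF hγ' hγ, hν.augment_le_of_upper hF hV hμ' h.ge⟩

/-- In degree below `deg F` the valuation is squeezed to the ultimate value. In any other `f` one
term of the expansion is strictly smallest at `γ'`, so the values on these polynomials and on `F`
determine `μ' f`. -/
theorem eq_augment_of_le (hdiv : ∀ n : ℕ, n ≠ 0 → ∀ x : Λ, ∃ z, n • z = x)
    (hν : IsIncreasing v e ν) (hF : IsMinUnstable ν F)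
    (hγ' : InCut e ν F γ') {D : Set Λ} {μ' : K[X] → WithTop Λ} (hV : μ' ∈ extVals v e D)
    (hμ' : ∀ i, ν i ≤ μ') (hle : μ' ≤ augment (stableVal ν) F γ) (h : μ' F = (γ' : WithTop Λ)) :
    μ' = augment (stableVal ν) F γ' := by
  refine le_antisymm (fun f => ?_) (hν.augment_le_of_upper hF hV hμ' h.ge)
  rcases eq_or_ne f 0 with rfl | hf
  · rw [(hν.augment_eq_top_iff hF _ _).2 rfl]; exact le_top
  obtain ⟨g, n, hn0, hg, haug, -⟩ := hν.exists_leading_term hdiv hF hγ' hf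
  have hlow : ∀ f : K[X], f.degree < F.degree → μ' f = stableVal ν f := by
    intro f hf
    refine le_antisymm ((hle f).trans_eq ?_) (hν.stableVal_le_of_upper hF hμ' hf)
    exact augment_of_degree_lt hF.monic (hν.pos hF) hν.stableVal_zero hf
  have hlt : augment (stableVal ν) F γ' f <
      augment (stableVal ν) F γ' (f - expCoeff F f n * F ^ n) := by
    refine lt_augment_sub_term hF.monic hν.stableVal_zero ?_ fun k hk => ?_
    · rw [haug]; exact WithTop.coe_lt_top _
    refine lt_of_le_of_ne (augment_le hF.monic (hν.pos hF) hν.stableVal_zero f k) ?_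
    rcases eq_or_ne (expCoeff F f k) 0 with h0 | h0
    · rw [h0, haug, hν.stableVal_zero, top_add]
      exact WithTop.coe_ne_top
    · obtain ⟨g', hg'⟩ := hν.stableVal_range (hν.stable hF (degree_expCoeff_lt hF.monic f k)) h0
      rw [haug, hg']
      intro heq
      exact hk (hν.index_eq hdiv hF hγ' (by exact_mod_cast heq : e g + n • γ' = e g' + k • γ')).symm
  have hlt' := hlt.trans_le (hν.augment_le_of_upper hF hV hμ' h.ge _)
  obtain ⟨⟨w, hw⟩, -, -⟩ := hV
  have hterm : μ' (expCoeff F f n * F ^ n) = augment (stableVal ν) F γ' f := by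
    rw [← hw, w.map_mul, w.map_pow, hw, hw, hlow _ (degree_expCoeff_lt hF.monic f n), hg, h, haug]
    rfl
  rw [← hterm, ← hw, ← hw] at hlt'
  have := w.map_add_eq_of_lt_left hlt'
  rw [add_sub_cancel, hw, hw, hterm] at this
  exact this.le

/-- Being a supremum, `μ'` has an equivalent `μ₁` below `μ_{F,γ}`. This `μ₁` is again an upper
bound, hence is some `μ_{F,γ'}` with `γ'` in the same cut. -/
theorem equivalent_of_isSup (hdiv : ∀ n : ℕ, n ≠ 0 → ∀ x : Λ, ∃ z, n • z = x)
    (he : Function.Injective e) (hv : ∀ g : Γ, ∃ c : K, v c = (g : WithTop Γ))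
    (hν : IsIncreasing v e ν) (hF : IsMinUnstable ν F)
    (hγ : InCut e ν F γ) {D : Set Λ} (hD : ∀ x ∈ D, ∀ (g : Γ) (n : ℕ), e g + n • x ∈ D)
    (hγD : γ ∈ D) {μ' : K[X] → WithTop Λ} (hsup : IsSup (extVals v e D) ν μ') :
    Equivalent μ' (augment (stableVal ν) F γ) := by
  obtain ⟨μ₁, hV₁, heq, hle⟩ := hsup.least _
    (hν.augment_mem hdiv hF hγ hD hγD (Or.inr ⟨γ, hγD, rfl⟩) le_rfl)
    (hν.le_augment hdiv hF hγ le_rfl)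
  -- Both `μ₁` and `μ'` extend `v`, and `v` takes every value in `Γ`, so the isomorphism `τ` fixes
  -- `e g`. The finite values of `ν i` have this form, so the bound `ν i ≤ μ'` pulls back along `τ`.
  have hup : ∀ i, ν i ≤ μ₁ := by
    intro i f
    rcases eq_or_ne (μ₁ f) ⊤ with ht | ht
    · rw [ht]; exact le_top
    have hf : f ≠ 0 := by
      rintro rfl
      obtain ⟨⟨w, hw⟩, -, -⟩ := hV₁
      exact ht (by rw [← hw, w.map_zero])
    obtain ⟨τ, hτ⟩ := heq
    obtain ⟨g, hg⟩ := hν.range i f hf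
    obtain ⟨c, hc⟩ := hv g
    obtain ⟨x, hx⟩ := WithTop.ne_top_iff_exists.1 ht
    have h1 : μ₁ (C c) = (e g : WithTop Λ) := by rw [hV₁.2.1, hc]; rfl
    have h2 := (hτ (C c)).2 ⟨e g, mem_valueGroup h1⟩ h1
    rw [hsup.mem.2.1, hc, WithTop.map_coe, WithTop.coe_inj] at h2
    have h3 := (hτ f).2 ⟨x, mem_valueGroup hx.symm⟩ hx.symm
    have h4 := hsup.upper i f
    rw [hg, h3, WithTop.coe_le_coe, h2, Subtype.coe_le_coe, OrderIsoClass.map_le_map_iff] at h4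
    rw [hg, ← hx, WithTop.coe_le_coe]
    exact h4
  have hF' : μ₁ F ≤ (γ : WithTop Λ) := (hle F).trans_eq (hν.augment_self hF γ)
  obtain ⟨γ', -, h, hγ'⟩ := hν.exists_inCut_of_upper hF hγ hV₁ hup hF'
  have := hν.eq_augment_of_le hdiv hF hγ' hV₁ hup hle h
  rw [this] at heq
  exact heq.symm.trans (hν.equivalent_augment hdiv he hF hγ' hγ)

theorem degree_sub_lt (hF : IsMinUnstable ν F) (hG : IsMinUnstable ν G) :
    (G - F).degree < F.degree := by
  have h1 : F.natDegree = G.natDegree :=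
    le_antisymm (hF.least G hG.unstable) (hG.least F hF.unstable)
  have h2 : G.degree = F.degree := by
    rw [degree_eq_natDegree hG.monic.ne_zero, degree_eq_natDegree hF.monic.ne_zero, h1]
  rw [← h2]
  exact Polynomial.degree_sub_lt_left h2 hG.monic.ne_zero (by rw [hG.monic, hF.monic])

/-- Otherwise the values of `F` would overtake that of `G - F`, and `G = F + (G - F)` would be
stable. -/
theorem lt_stableVal_sub (hν : IsIncreasing v e ν) (hF : IsMinUnstable ν F)
    (hG : IsMinUnstable ν G) (i : J) : ν i F < stableVal ν (G - F) := by
  by_contra! hle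
  have hst := hν.stable hF (degree_sub_lt hF hG)
  apply hG.unstable
  refine isStable_of_eventually (c := stableVal ν (G - F)) ?_
  filter_upwards [hst.eventually_eq, eventually_gt_atTop i] with j h1 h2
  have h3 := hle.trans_lt (hν.strict F hF.unstable h2)
  obtain ⟨w, hw⟩ := hν.val j
  simp only [← hw] at h1 h3 ⊢
  rw [← h1] at h3 ⊢
  have := w.map_add_eq_of_lt_left h3
  rwa [sub_add_cancel] at this

theorem eventually_eq_of_min (hν : IsIncreasing v e ν) (hF : IsMinUnstable ν F)
    (hG : IsMinUnstable ν G) : ∀ᶠ i in atTop, ν i G = ν i F := by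
  filter_upwards [(hν.stable hF (degree_sub_lt hF hG)).eventually_eq] with i h1
  have h3 := hν.lt_stableVal_sub hF hG i
  rw [← h1] at h3
  obtain ⟨w, hw⟩ := hν.val i
  simp only [← hw] at h3 ⊢
  have := w.map_add_eq_of_lt_left h3
  rwa [add_sub_cancel] at this

theorem exists_le_iff_of_min (hν : IsIncreasing v e ν) (hF : IsMinUnstable ν F)
    (hG : IsMinUnstable ν G) (x : WithTop Λ) : (∃ i, x ≤ ν i G) ↔ ∃ i, x ≤ ν i F := by
  have h : ∀ F G : K[X], (∀ᶠ i in atTop, ν i G = ν i F) → (∃ i, x ≤ ν i G) → ∃ i, x ≤ ν i F := by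
    rintro F G hev ⟨i, hi⟩
    obtain ⟨j, h1, h2⟩ := (hev.and (eventually_ge_atTop i)).exists
    exact ⟨j, by rw [← h1]; exact hi.trans (hν.mono h2 G)⟩
  exact ⟨h F G (hν.eventually_eq_of_min hF hG), h G F (hν.eventually_eq_of_min hG hF)⟩

theorem cutOf_eq_of_min (hν : IsIncreasing v e ν) (hF : IsMinUnstable ν F)
    (hG : IsMinUnstable ν G) (D : Set Λ) : cutOf D ν G = cutOf D ν F := by
  simp only [cutOf, hν.exists_le_iff_of_min hF hG]

/-- The value of `G - F` is `⊤` or an element of `Γ` above all `ν i F`, hence above `γ`; so `G` has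
value at least `γ` in the valuation attached to `F`. -/
theorem augment_le_augment_of_min (hdiv : ∀ n : ℕ, n ≠ 0 → ∀ x : Λ, ∃ z, n • z = x)
    (hν : IsIncreasing v e ν) (hF : IsMinUnstable ν F) (hG : IsMinUnstable ν G)
    (hγ : InCut e ν F γ) : augment (stableVal ν) G γ ≤ augment (stableVal ν) F γ := by
  have hk := hν.isKey hdiv hF hγ le_rfl
  have hdeg : G.degree = F.degree := by
    rw [degree_eq_natDegree hG.monic.ne_zero, degree_eq_natDegree hF.monic.ne_zero,
      le_antisymm (hF.least G hG.unstable) (hG.least F hF.unstable)]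
  refine fun f => augment_le_valuation hG.monic (hν.pos hG) hk.valuation (fun g hg => ?_) ?_ f
  · rw [hk.valuation_apply, augment_of_degree_lt hk.monic hk.pos hk.map_zero (by rwa [← hdeg])]
  · have hlt := degree_sub_lt hF hG
    have h1 : (γ : WithTop Λ) ≤ hk.valuation (G - F) := by
      rw [hk.valuation_apply, augment_of_degree_lt hk.monic hk.pos hk.map_zero hlt]
      rcases eq_or_ne (G - F) 0 with h0 | h0
      · rw [h0, hk.map_zero]; exact le_top
      obtain ⟨g, hg⟩ := hν.stableVal_range (hν.stable hF hlt) h0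
      rw [hg, WithTop.coe_le_coe]
      refine (hγ.above _ (map_mem_divClosure e g) fun i => ?_).le
      rw [← hg]
      exact hν.lt_stableVal_sub hF hG i
    have h2 : (γ : WithTop Λ) ≤ hk.valuation F := by
      rw [hk.valuation_apply, hν.augment_self hF]
    simpa using hk.valuation.map_le_add h1 h2

theorem augment_eq_of_min (hdiv : ∀ n : ℕ, n ≠ 0 → ∀ x : Λ, ∃ z, n • z = x)
    (hν : IsIncreasing v e ν) (hF : IsMinUnstable ν F) (hG : IsMinUnstable ν G)
    (hγ : InCut e ν F γ) : augment (stableVal ν) G γ = augment (stableVal ν) F γ := by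
  have hγ' : InCut e ν G γ := by
    apply hν.inCut_of_quasiCut_eq hG
    rw [hν.cutOf_eq_of_min hF hG, quasiCut_eq_of_inCut hγ]
  exact le_antisymm (hν.augment_le_augment_of_min hdiv hF hG hγ)
    (hν.augment_le_augment_of_min hdiv hG hF hγ')

theorem exists_le_of_cofinal (hcof : (cutOf (divClosure e) ν F).1 = divClosure e) (g : Γ) :
    ∃ i, (e g : WithTop Λ) ≤ ν i F := by
  have h : e g ∈ (cutOf (divClosure e) ν F).1 := by rw [hcof]; exact map_mem_divClosure e g
  exact h.2

/-- A nonzero `G - F` would have a value in `Γ` above all the `ν i F`, which are cofinal. -/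
theorem eq_of_cofinal (hν : IsIncreasing v e ν) (hF : IsMinUnstable ν F) (hG : IsMinUnstable ν G)
    (hcof : (cutOf (divClosure e) ν F).1 = divClosure e) : G = F := by
  by_contra hne
  obtain ⟨g, hg⟩ := hν.stableVal_range (hν.stable hF (degree_sub_lt hF hG)) (sub_ne_zero.2 hne)
  obtain ⟨i, hi⟩ := exists_le_of_cofinal hcof g
  have := hν.lt_stableVal_sub hF hG i
  rw [hg] at this
  exact absurd this (not_lt.2 hi)

theorem isLeast_augment_top (hdiv : ∀ n : ℕ, n ≠ 0 → ∀ x : Λ, ∃ z, n • z = x)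
    (hν : IsIncreasing v e ν) (hF : IsMinUnstable ν F)
    (hγ : InCut e ν F γ) {D : Set Λ} (hD : ∀ x ∈ D, ∀ (g : Γ) (n : ℕ), e g + n • x ∈ D)
    (hγD : γ ∈ D) (hcof : (cutOf (divClosure e) ν F).1 = divClosure e) :
    IsLeast {μ' ∈ extVals v e D |
      (∀ f, (∀ g ∈ divClosure e, (g : WithTop Λ) ≤ μ' f) → μ' f = ⊤) ∧ ∀ i, ν i ≤ μ'}
      (augment (stableVal ν) F ⊤) := by
  constructor
  · refine ⟨hν.augment_mem hdiv hF hγ hD hγD (Or.inl rfl) le_top, fun f hf => ?_,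
      hν.le_augment hdiv hF hγ le_top⟩
    have hlo := degree_modByMonic_lt f hF.monic
    rw [augment_top hF.monic (hν.pos hF) hν.stableVal_zero] at hf ⊢
    -- A nonzero remainder has its value in the image of `Γ`, and by cofinality some `ν j F` exceeds
    -- it.
    by_contra hne
    have h0 : f %ₘ F ≠ 0 := by
      intro h0
      rw [h0] at hne
      exact hne hν.stableVal_zero
    obtain ⟨g, hg⟩ := hν.stableVal_range (hν.stable hF hlo) h0
    obtain ⟨i, hi⟩ := exists_le_of_cofinal hcof g
    obtain ⟨y, hy, hmono⟩ := hν.exists_values hF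
    obtain ⟨j, hj⟩ := exists_gt i
    have h1 := hf (e (y j)) (map_mem_divClosure e _)
    rw [hg, WithTop.coe_le_coe] at h1
    rw [hy, WithTop.coe_le_coe] at hi
    exact absurd (hmono hj) (not_lt.2 (h1.trans hi))
  · rintro μ' ⟨hV, hfin, hup⟩
    refine hν.augment_le_of_upper hF hV hup ?_
    rw [hfin F fun x hx => ?_]
    rw [← hcof] at hx
    obtain ⟨-, i, hi⟩ := hx
    exact hi.trans (hup i F)

end IsIncreasing

end Family

/-! ### Separation of sets in a Hahn product -/

section HahnCuts

variable {I : Type*} [LinearOrder I]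

/-- The coefficients of an element of a Hahn product. -/
def coef (x : Hahn I) (i : I) : ℝ := (ofLex x).coeff i

theorem coef_add (x y : Hahn I) (i : I) : coef (x + y) i = coef x i + coef y i := rfl

theorem coef_neg (x : Hahn I) (i : I) : coef (-x) i = -coef x i := rfl

theorem coef_nsmul (n : ℕ) (x : Hahn I) (i : I) : coef (n • x) i = n • coef x i := by
  induction n with
  | zero => simp [coef]
  | succ n ih => rw [succ_nsmul, succ_nsmul, coef_add, ih]

theorem hahn_lt_iff (x y : Hahn I) :
    x < y ↔ ∃ i, (∀ j, j < i → coef x j = coef y j) ∧ coef x i < coef y i :=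
  HahnSeries.lt_iff x y

theorem hahn_ext {x y : Hahn I} (h : ∀ i, coef x i = coef y i) : x = y :=
  ofLex.injective (HahnSeries.ext (funext h))

/-- `x` and `y` first differ at an index in `T`, where the coefficient of `x` is smaller. -/
def LtOn (T : LowerSet I) (x y : Hahn I) : Prop :=
  ∃ i ∈ T, (∀ j, j < i → coef x j = coef y j) ∧ coef x i < coef y i

/-- `x` and `y` have the same coefficients in `T`. -/
def EqOn (T : LowerSet I) (x y : Hahn I) : Prop := ∀ i ∈ T, coef x i = coef y i

theorem EqOn.symm {T : LowerSet I} {x y : Hahn I} (h : EqOn T x y) : EqOn T y x :=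
  fun i hi => (h i hi).symm

theorem ltOn_trichotomy (T : LowerSet I) (x y : Hahn I) :
    LtOn T x y ∨ EqOn T x y ∨ LtOn T y x := by
  rcases lt_trichotomy x y with h | h | h
  · obtain ⟨i, h1, h2⟩ := (hahn_lt_iff x y).1 h
    by_cases hi : i ∈ T
    · exact Or.inl ⟨i, hi, h1, h2⟩
    · refine Or.inr (Or.inl fun j hj => h1 j ?_)
      by_contra hji
      exact hi (T.lower (not_lt.1 hji) hj)
  · exact Or.inr (Or.inl fun j _ => by rw [h])
  · obtain ⟨i, h1, h2⟩ := (hahn_lt_iff y x).1 h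
    by_cases hi : i ∈ T
    · exact Or.inr (Or.inr ⟨i, hi, h1, h2⟩)
    · refine Or.inr (Or.inl fun j hj => (h1 j ?_).symm)
      by_contra hji
      exact hi (T.lower (not_lt.1 hji) hj)

theorem LtOn.neg {T : LowerSet I} {x y : Hahn I} (h : LtOn T x y) : LtOn T (-y) (-x) := by
  obtain ⟨i, hi, h1, h2⟩ := h
  exact ⟨i, hi, fun j hj => by rw [coef_neg, coef_neg, h1 j hj],
    by rw [coef_neg, coef_neg]; exact neg_lt_neg h2⟩

theorem EqOn.neg {T : LowerSet I} {x y : Hahn I} (h : EqOn T x y) : EqOn T (-x) (-y) :=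
  fun i hi => by rw [coef_neg, coef_neg, h i hi]

theorem coef_hahnIncl_idx (x : Hahn I) (i : I) : coef (hahnIncl I x) (ExtIndex.idx i) = coef x i :=
  HahnSeries.embDomain_coeff (f := ExtIndex.idxEmb I)

theorem coef_hahnIncl_gap (x : Hahn I) (S : LowerSet I) :
    coef (hahnIncl I x) (ExtIndex.gap S) = 0 := by
  refine HahnSeries.embDomain_of_notMem_range (f := ExtIndex.idxEmb I) ?_
  rintro ⟨i, hi⟩
  cases hi

theorem hahnIncl_strictMono : StrictMono (hahnIncl I) := by
  intro x y h
  obtain ⟨i, h1, h2⟩ := (hahn_lt_iff x y).1 h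
  refine (hahn_lt_iff _ _).2 ⟨ExtIndex.idx i, fun j hj => ?_, ?_⟩
  · cases j with
    | idx j => rw [coef_hahnIncl_idx, coef_hahnIncl_idx, h1 j ((ExtIndex.idx_lt_idx _ _).1 hj)]
    | gap S => rw [coef_hahnIncl_gap, coef_hahnIncl_gap]
  · rwa [coef_hahnIncl_idx, coef_hahnIncl_idx]

/-- The element of the Hahn product with the single coefficient `1` at `i_S`. -/
noncomputable def gapElt (S : LowerSet I) : Hahn (ExtIndex I) :=
  toLex (HahnSeries.single (ExtIndex.gap S) 1)

theorem coef_gapElt_self (S : LowerSet I) : coef (gapElt S) (ExtIndex.gap S) = 1 :=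
  HahnSeries.coeff_single_same _ _

theorem coef_gapElt_of_ne {S : LowerSet I} {j : ExtIndex I} (h : j ≠ ExtIndex.gap S) :
    coef (gapElt S) j = 0 :=
  HahnSeries.coeff_single_of_ne h

/-- The index `i_S` follows all indices of `S` and precedes the others. A positive coefficient there
leaves comparisons decided in `S` untouched and wins against everything that agrees with `z` on `S`.
-/
theorem lt_add_gapElt {S : LowerSet I} {x z : Hahn I} (h : LtOn S x z ∨ EqOn S x z) :
    hahnIncl I x < hahnIncl I z + gapElt S := by
  rw [hahn_lt_iff]
  rcases h with ⟨i, hi, h1, h2⟩ | h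
  · refine ⟨ExtIndex.idx i, fun j hj => ?_, ?_⟩
    · rw [coef_add, coef_gapElt_of_ne (hj.trans ((ExtIndex.idx_lt_gap i S).2 hi)).ne, add_zero]
      cases j with
      | idx j => rw [coef_hahnIncl_idx, coef_hahnIncl_idx, h1 j ((ExtIndex.idx_lt_idx _ _).1 hj)]
      | gap S => rw [coef_hahnIncl_gap, coef_hahnIncl_gap]
    · rwa [coef_add, coef_gapElt_of_ne (by simp), add_zero, coef_hahnIncl_idx, coef_hahnIncl_idx]
  · refine ⟨ExtIndex.gap S, fun j hj => ?_, ?_⟩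
    · rw [coef_add, coef_gapElt_of_ne hj.ne, add_zero]
      cases j with
      | idx j => rw [coef_hahnIncl_idx, coef_hahnIncl_idx, h j ((ExtIndex.idx_lt_gap _ _).1 hj)]
      | gap S => rw [coef_hahnIncl_gap, coef_hahnIncl_gap]
    · rw [coef_add, coef_gapElt_self, coef_hahnIncl_gap, coef_hahnIncl_gap]
      norm_num

theorem add_gapElt_lt {S : LowerSet I} {x z : Hahn I} (h : LtOn S z x) :
    hahnIncl I z + gapElt S < hahnIncl I x := by
  obtain ⟨i, hi, h1, h2⟩ := h
  rw [hahn_lt_iff]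
  refine ⟨ExtIndex.idx i, fun j hj => ?_, ?_⟩
  · rw [coef_add, coef_gapElt_of_ne (hj.trans ((ExtIndex.idx_lt_gap i S).2 hi)).ne, add_zero]
    cases j with
    | idx j => rw [coef_hahnIncl_idx, coef_hahnIncl_idx, h1 j ((ExtIndex.idx_lt_idx _ _).1 hj)]
    | gap S => rw [coef_hahnIncl_gap, coef_hahnIncl_gap]
  · rwa [coef_add, coef_gapElt_of_ne (by simp), add_zero, coef_hahnIncl_idx, coef_hahnIncl_idx]

theorem sub_gapElt_lt {S : LowerSet I} {x z : Hahn I} (h : LtOn S z x ∨ EqOn S z x) :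
    hahnIncl I z - gapElt S < hahnIncl I x := by
  have := lt_add_gapElt (h.imp LtOn.neg fun h => h.symm.neg)
  rw [map_neg, map_neg] at this
  rw [sub_lt_iff_lt_add]
  have h2 := add_lt_add_right this (hahnIncl I x + hahnIncl I z)
  convert h2 using 1 <;> abel

theorem lt_sub_gapElt {S : LowerSet I} {x z : Hahn I} (h : LtOn S x z) :
    hahnIncl I x < hahnIncl I z - gapElt S := by
  have := add_gapElt_lt h.neg
  rw [map_neg, map_neg, lt_neg] at this
  refine this.trans_eq ?_
  abel

section Cut

variable {L U : Set (Hahn I)}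

/-- The initial segment of the indices up to which some elements of `L` and `U` agree. -/
def agreeSet (L U : Set (Hahn I)) : LowerSet I where
  carrier := {i | ∃ l ∈ L, ∃ u ∈ U, EqOn (LowerSet.Iic i) l u}
  lower' := by
    rintro i j hji ⟨l, hl, u, hu, h⟩
    exact ⟨l, hl, u, hu, fun k hk => h k (le_trans (LowerSet.mem_Iic_iff.1 hk) hji)⟩

theorem mem_agreeSet {i : I} :
    i ∈ agreeSet L U ↔ ∃ l ∈ L, ∃ u ∈ U, EqOn (LowerSet.Iic i) l u := Iff.rfl

theorem not_lt_of_ltOn {T : LowerSet I} {x x' y y' : Hahn I} (hx : EqOn T x x') (hy : EqOn T y y')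
    (h : LtOn T x y) : x' < y' := by
  obtain ⟨i, hi, h1, h2⟩ := h
  refine (hahn_lt_iff _ _).2 ⟨i, fun j hj => ?_, ?_⟩
  · rw [← hx j (T.lower hj.le hi), ← hy j (T.lower hj.le hi), h1 j hj]
  · rwa [← hx i hi, ← hy i hi]

/-- If `l` were smaller than `l'` on `T`, then `u`, which agrees with `l` there, would be below
`l'`. -/
theorem eqOn_of_agree (hLU : ∀ l ∈ L, ∀ u ∈ U, l < u) {T : LowerSet I} {l u l' u' : Hahn I}
    (hl : l ∈ L) (hu : u ∈ U) (hl' : l' ∈ L) (hu' : u' ∈ U) (h : EqOn T l u)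
    (h' : EqOn T l' u') : EqOn T l l' := by
  rcases ltOn_trichotomy T l l' with h1 | h1 | h1
  · exact absurd (hLU l' hl' u hu) (not_lt.2 (not_lt_of_ltOn h (fun _ _ => rfl) h1).le)
  · exact h1
  · exact absurd (hLU l hl u' hu') (not_lt.2 (not_lt_of_ltOn h' (fun _ _ => rfl) h1).le)

/-- The element of the Hahn product with support in the agreement set that agrees with the elements
of `L` and `U` as long as these agree. -/
theorem exists_agree (hLU : ∀ l ∈ L, ∀ u ∈ U, l < u) :
    ∃ x : Hahn I, ∀ i ∈ agreeSet L U, ∃ l ∈ L, ∃ u ∈ U,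
      EqOn (LowerSet.Iic i) l x ∧ EqOn (LowerSet.Iic i) u x := by
  classical
  choose l hl u hu h using fun i : agreeSet L U => mem_agreeSet.1 i.2
  let c : I → ℝ := fun i => if hi : i ∈ agreeSet L U then coef (l ⟨i, hi⟩) i else 0
  have hc : ∀ i : agreeSet L U, ∀ j ≤ (i : I), c j = coef (l i) j := by
    intro i j hj
    have hjS : j ∈ agreeSet L U := (agreeSet L U).lower hj i.2
    simp only [c, dif_pos hjS]
    exact eqOn_of_agree hLU (hl _) (hu _) (hl i) (hu i) (h ⟨j, hjS⟩)
      (fun k hk => h i k (le_trans (LowerSet.mem_Iic_iff.1 hk) hj)) j (LowerSet.mem_Iic_iff.2 le_rfl)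
  -- Up to `s 0` the family `c` coincides with the coefficients of a single element of `L`, whose
  -- support is well ordered, so no descending sequence exists.
  have hpwo : (Function.support c).IsPWO := by
    rw [Set.isPWO_iff_isWF, Set.isWF_iff_no_descending_seq]
    intro s hs hmem
    have h0 : s 0 ∈ agreeSet L U := by
      by_contra hn
      exact hmem 0 (by simp only [c, dif_neg hn])
    have hwf := (ofLex (l ⟨s 0, h0⟩)).isWF_support
    refine Set.isWF_iff_no_descending_seq.1 hwf s hs fun n => ?_
    have := hc ⟨s 0, h0⟩ (s n) (hs.antitone (Nat.zero_le n))
    have h1 := hmem n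
    rw [Function.mem_support, this] at h1
    exact h1
  refine ⟨toLex ⟨c, hpwo⟩, fun i hi => ⟨l ⟨i, hi⟩, hl _, u ⟨i, hi⟩, hu _, fun j hj => ?_,
    fun j hj => ?_⟩⟩
  · exact (hc ⟨i, hi⟩ j (LowerSet.mem_Iic_iff.1 hj)).symm
  · rw [← h ⟨i, hi⟩ j hj]
    exact (hc ⟨i, hi⟩ j (LowerSet.mem_Iic_iff.1 hj)).symm

theorem add_gapElt_mem_smallExt (S : LowerSet I) (z : Hahn I) :
    hahnIncl I z + gapElt S ∈ smallExt I := by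
  refine ⟨S, fun j hj => ?_⟩
  cases j with
  | idx j => exact Or.inl ⟨j, rfl⟩
  | gap T =>
    by_contra hne
    refine hj ?_
    change coef (hahnIncl I z + gapElt S) (ExtIndex.gap T) = 0
    rw [coef_add, coef_hahnIncl_gap, coef_gapElt_of_ne fun h => hne (Or.inr h), add_zero]

theorem sub_gapElt_mem_smallExt (S : LowerSet I) (z : Hahn I) :
    hahnIncl I z - gapElt S ∈ smallExt I := by
  refine ⟨S, fun j hj => ?_⟩
  cases j with
  | idx j => exact Or.inl ⟨j, rfl⟩
  | gap T =>
    by_contra hne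
    refine hj ?_
    change coef (hahnIncl I z - gapElt S) (ExtIndex.gap T) = 0
    rw [sub_eq_add_neg, coef_add, coef_neg, coef_hahnIncl_gap,
      coef_gapElt_of_ne fun h => hne (Or.inr h), neg_zero, add_zero]

/-- Here the agreement set is exactly the set of indices below some `j`. At `j`, the coefficients of
the elements of `L` and `U` that agree with `x` so far are separated real sets, and a supremum `r`
is inserted between them. -/
theorem exists_separating_of_eqOn (hLU : ∀ l ∈ L, ∀ u ∈ U, l < u) {x : Hahn I}
    (hL : ∀ l ∈ L, LtOn (agreeSet L U) l x ∨ EqOn (agreeSet L U) l x)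
    (hU : ∀ u ∈ U, LtOn (agreeSet L U) x u ∨ EqOn (agreeSet L U) x u) {l₀ u₀ : Hahn I}
    (hl₀ : l₀ ∈ L) (hu₀ : u₀ ∈ U) (hlx : EqOn (agreeSet L U) l₀ x)
    (hxu : EqOn (agreeSet L U) x u₀) :
    ∃ y ∈ smallExt I, (∀ l ∈ L, hahnIncl I l < y) ∧ ∀ u ∈ U, y < hahnIncl I u := by
  obtain ⟨j, hj1, hj2⟩ := (hahn_lt_iff _ _).1 (hLU l₀ hl₀ u₀ hu₀)
  have hjS : j ∉ agreeSet L U := fun hj => hj2.ne ((hlx j hj).trans (hxu j hj))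
  have hlt : ∀ i, i ∈ agreeSet L U ↔ i < j := by
    intro i
    constructor
    · intro hi
      by_contra hji
      exact hjS ((agreeSet L U).lower (not_lt.1 hji) hi)
    · intro hi
      exact ⟨l₀, hl₀, u₀, hu₀, fun k hk => hj1 k ((LowerSet.mem_Iic_iff.1 hk).trans_lt hi)⟩
  have hsep : ∀ l ∈ L, ∀ u ∈ U, EqOn (agreeSet L U) l x → EqOn (agreeSet L U) x u →
      coef l j < coef u j := by
    intro l hl u hu h1 h2
    have h3 : ∀ i, i < j → coef l i = coef u i := fun i hi =>
      (h1 i ((hlt i).2 hi)).trans (h2 i ((hlt i).2 hi))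
    by_contra! hle
    rcases hle.eq_or_lt with heq | hgt
    · refine hjS ⟨l, hl, u, hu, fun i hi => ?_⟩
      rcases (LowerSet.mem_Iic_iff.1 hi).eq_or_lt with rfl | hi
      · exact heq.symm
      · exact h3 i hi
    · exact absurd (hLU l hl u hu)
        (not_lt.2 ((hahn_lt_iff u l).2 ⟨j, fun i hi => (h3 i hi).symm, hgt⟩).le)
  set A : Set ℝ := {t | ∃ l ∈ L, EqOn (agreeSet L U) l x ∧ coef l j = t} with hA
  have hAne : A.Nonempty := ⟨_, l₀, hl₀, hlx, rfl⟩
  have hAub : ∀ u ∈ U, EqOn (agreeSet L U) x u → coef u j ∈ upperBounds A := by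
    rintro u hu hxu _ ⟨l, hl, hlx, rfl⟩
    exact (hsep l hl u hu hlx hxu).le
  set r := sSup A with hr
  let z : Hahn I := x + toLex (HahnSeries.single j (r - coef x j))
  have hz1 : ∀ i, i < j → coef z i = coef x i := by
    intro i hi
    change coef x i + (HahnSeries.single j (r - coef x j)).coeff i = _
    rw [HahnSeries.coeff_single_of_ne hi.ne, add_zero]
  have hz2 : coef z j = r := by
    change coef x j + (HahnSeries.single j (r - coef x j)).coeff j = _
    rw [HahnSeries.coeff_single_same]
    ring
  have hjT : j ∈ LowerSet.Iic j := LowerSet.mem_Iic_iff.2 le_rfl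
  have hL' : ∀ l ∈ L, LtOn (LowerSet.Iic j) l z ∨
      (EqOn (LowerSet.Iic j) l z ∧ r ∈ A) := by
    intro l hl
    rcases hL l hl with ⟨i, hi, h1, h2⟩ | h
    · have hij := (hlt i).1 hi
      refine Or.inl ⟨i, LowerSet.mem_Iic_iff.2 hij.le, fun k hk => ?_, ?_⟩
      · rw [h1 k hk, hz1 k (hk.trans hij)]
      · rwa [hz1 i hij]
    · have h1 : ∀ i, i < j → coef l i = coef z i := fun i hi => by
        rw [hz1 i hi, h i ((hlt i).2 hi)]
      have hmem : coef l j ∈ A := ⟨l, hl, h, rfl⟩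
      rcases (le_csSup ⟨_, hAub u₀ hu₀ hxu⟩ hmem).lt_or_eq with h2 | h2
      · exact Or.inl ⟨j, hjT, h1, by rwa [hz2]⟩
      · refine Or.inr ⟨fun i hi => ?_, by rwa [h2] at hmem⟩
        rcases (LowerSet.mem_Iic_iff.1 hi).eq_or_lt with rfl | hi
        · rw [h2, hz2]
        · exact h1 i hi
  have hU' : ∀ u ∈ U, LtOn (LowerSet.Iic j) z u ∨ (EqOn (LowerSet.Iic j) z u ∧ r ∉ A) := by
    intro u hu
    rcases hU u hu with ⟨i, hi, h1, h2⟩ | h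
    · have hij := (hlt i).1 hi
      refine Or.inl ⟨i, LowerSet.mem_Iic_iff.2 hij.le, fun k hk => ?_, ?_⟩
      · rw [← h1 k hk, hz1 k (hk.trans hij)]
      · rwa [hz1 i hij]
    · have h1 : ∀ i, i < j → coef z i = coef u i := fun i hi => by
        rw [hz1 i hi, h i ((hlt i).2 hi)]
      rcases (csSup_le hAne (hAub u hu h)).lt_or_eq with h2 | h2
      · exact Or.inl ⟨j, hjT, h1, by rwa [hz2]⟩
      · refine Or.inr ⟨fun i hi => ?_, ?_⟩
        · rcases (LowerSet.mem_Iic_iff.1 hi).eq_or_lt with rfl | hi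
          · rw [hz2]; exact h2
          · exact h1 i hi
        · rintro ⟨l, hl, hlx', hl'⟩
          exact (hsep l hl u hu hlx' h).ne (hl'.trans h2)
  -- The coefficient `r` may be attained in `L` or in `U` but not in both; the sign at the gap
  -- behind `j` moves the element to the correct side.
  by_cases hrA : r ∈ A
  · refine ⟨_, add_gapElt_mem_smallExt (LowerSet.Iic j) z,
      fun l hl => lt_add_gapElt ((hL' l hl).imp_right And.left), fun u hu => add_gapElt_lt ?_⟩
    exact (hU' u hu).resolve_right fun h => h.2 hrA
  · refine ⟨_, sub_gapElt_mem_smallExt (LowerSet.Iic j) z, fun l hl => lt_sub_gapElt ?_,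
      fun u hu => sub_gapElt_lt ((hU' u hu).imp_right And.left)⟩
    exact (hL' l hl).resolve_right fun h => hrA h.2

/-- Every pair of separated sets in the Hahn product is strictly separated by an element of the
small extension. -/
theorem exists_separating (hLU : ∀ l ∈ L, ∀ u ∈ U, l < u) :
    ∃ y ∈ smallExt I, (∀ l ∈ L, hahnIncl I l < y) ∧ ∀ u ∈ U, y < hahnIncl I u := by
  obtain ⟨x, hx⟩ := exists_agree hLU
  have hL : ∀ l ∈ L, LtOn (agreeSet L U) l x ∨ EqOn (agreeSet L U) l x := by
    intro l hl
    rcases ltOn_trichotomy (agreeSet L U) l x with h | h | ⟨i, hi, h⟩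
    · exact Or.inl h
    · exact Or.inr h
    · obtain ⟨-, -, u, hu, -, h2⟩ := hx i hi
      exact absurd (hLU l hl u hu) (not_lt.2 (not_lt_of_ltOn h2.symm (fun _ _ => rfl)
        ⟨i, LowerSet.mem_Iic_iff.2 le_rfl, h⟩).le)
  have hU : ∀ u ∈ U, LtOn (agreeSet L U) x u ∨ EqOn (agreeSet L U) x u := by
    intro u hu
    rcases ltOn_trichotomy (agreeSet L U) x u with h | h | ⟨i, hi, h⟩
    · exact Or.inl h
    · exact Or.inr h
    · obtain ⟨l, hl, -, -, h1, -⟩ := hx i hi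
      exact absurd (hLU l hl u hu) (not_lt.2 (not_lt_of_ltOn (fun _ _ => rfl) h1.symm
        ⟨i, LowerSet.mem_Iic_iff.2 le_rfl, h⟩).le)
  -- If no element of one side agrees with `x` on the whole agreement set, a unit at its gap,
  -- pointing towards that side, suffices. Empty `L` or `U` is included.
  by_cases hA : ∃ u ∈ U, EqOn (agreeSet L U) x u
  · by_cases hB : ∃ l ∈ L, EqOn (agreeSet L U) l x
    · obtain ⟨u, hu, hxu⟩ := hA
      obtain ⟨l, hl, hlx⟩ := hB
      exact exists_separating_of_eqOn hLU hL hU hl hu hlx hxu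
    · push Not at hB
      exact ⟨_, sub_gapElt_mem_smallExt (agreeSet L U) x,
        fun l hl => lt_sub_gapElt ((hL l hl).resolve_right (hB l hl)),
        fun u hu => sub_gapElt_lt (hU u hu)⟩
  · push Not at hA
    exact ⟨_, add_gapElt_mem_smallExt (agreeSet L U) x, fun l hl => lt_add_gapElt (hL l hl),
      fun u hu => add_gapElt_lt ((hU u hu).resolve_right (hA u hu))⟩

end Cut

theorem exists_nsmul_eq (n : ℕ) (hn : n ≠ 0) (x : Hahn I) : ∃ z, n • z = x := by
  refine ⟨toLex ((n : ℝ)⁻¹ • ofLex x), hahn_ext fun i => ?_⟩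
  rw [coef_nsmul]
  change n • ((n : ℝ)⁻¹ * coef x i) = coef x i
  rw [nsmul_eq_mul, mul_inv_cancel_left₀ (Nat.cast_ne_zero.2 hn)]

section Embedding

variable {Γ : Type*} [AddCommGroup Γ] [LinearOrder Γ] [IsOrderedAddMonoid Γ]
  {ι : Γ →+o Hahn (FiniteArchimedeanClass Γ)}

theorem bigEmb_strictMono (hι : StrictMono ι) : StrictMono (bigEmb ι) :=
  hahnIncl_strictMono.comp hι

/-- The smaller Hahn product is already divisible and division is unique in the larger one, so no
gap coordinates arise. -/
theorem divClosure_bigEmb_subset (ι : Γ →+o Hahn (FiniteArchimedeanClass Γ)) :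
    divClosure (bigEmb ι) ⊆ Set.range (hahnIncl (FiniteArchimedeanClass Γ)) := by
  rintro x ⟨n, hn, g, hg⟩
  obtain ⟨z, hz⟩ := exists_nsmul_eq n hn.ne' (ι g)
  refine ⟨z, nsmul_right_injective hn.ne' ?_⟩
  change n • hahnIncl _ z = n • x
  rw [← hg, ← map_nsmul, hz]
  rfl

/-- `smallExt` is a union over varying `S`, so closure under sums is not available. Elements of `Γ`
have no gap coordinates and therefore preserve the segment `S` of `x`. -/
theorem bigEmb_add_nsmul_mem (ι : Γ →+o Hahn (FiniteArchimedeanClass Γ))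
    {x : Hahn (ExtIndex (FiniteArchimedeanClass Γ))} (hx : x ∈ smallExt (FiniteArchimedeanClass Γ))
    (g : Γ) (n : ℕ) : bigEmb ι g + n • x ∈ smallExt (FiniteArchimedeanClass Γ) := by
  obtain ⟨S, hS⟩ := hx
  refine ⟨S, fun j hj => ?_⟩
  cases j with
  | idx j => exact Or.inl ⟨j, rfl⟩
  | gap T =>
    by_contra hne
    refine hj ?_
    change coef (hahnIncl _ (ι g) + n • x) (ExtIndex.gap T) = 0
    have h0 : coef x (ExtIndex.gap T) = 0 := by
      by_contra h
      exact hne (hS h)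
    rw [coef_add, coef_hahnIncl_gap, coef_nsmul, h0, nsmul_zero, add_zero]

/-- Every cut of the divisible closure is induced by an element of the small extension. -/
theorem exists_cut_realization (ι : Γ →+o Hahn (FiniteArchimedeanClass Γ))
    {L U : Set (Hahn (ExtIndex (FiniteArchimedeanClass Γ)))}
    (hL : L ⊆ divClosure (bigEmb ι)) (hU : U ⊆ divClosure (bigEmb ι))
    (hLU : ∀ l ∈ L, ∀ u ∈ U, l < u) :
    ∃ γ ∈ smallExt (FiniteArchimedeanClass Γ), (∀ l ∈ L, l < γ) ∧ ∀ u ∈ U, γ < u := by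
  obtain ⟨γ, hγ, h1, h2⟩ := exists_separating (L := hahnIncl _ ⁻¹' L) (U := hahnIncl _ ⁻¹' U)
    fun l hl u hu => hahnIncl_strictMono.lt_iff_lt.1 (hLU _ hl _ hu)
  refine ⟨γ, hγ, fun l hl => ?_, fun u hu => ?_⟩
  · obtain ⟨l', rfl⟩ := divClosure_bigEmb_subset ι (hL hl)
    exact h1 l' hl
  · obtain ⟨u', rfl⟩ := divClosure_bigEmb_subset ι (hU hu)
    exact h2 u' hu

end Embedding

end HahnCuts

/-! ### The family attached to a pseudo-Cauchy sequence -/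

section SequenceFamily

variable {K Γ Λ I : Type*} [Field K]
  [AddCommGroup Γ] [LinearOrder Γ] [IsOrderedAddMonoid Γ]
  [AddCommGroup Λ] [LinearOrder Λ] [IsOrderedAddMonoid Λ] [LinearOrder I] [SuccOrder I]
  {v : AddValuation K (WithTop Γ)} {e : Γ →+ Λ} {a : I → K}

/-- The valuation `v` with values read in `Λ`. -/
noncomputable def readVal (v : AddValuation K (WithTop Γ)) (e : Γ →+ Λ) (he : StrictMono e) :
    AddValuation K (WithTop Λ) :=
  v.map e.withTopMap rfl he.monotone.withTop_map

theorem readVal_apply (he : StrictMono e) (c : K) : readVal v e he c = (v c).map e := rfl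

theorem readVal_eq_readVal_iff (he : StrictMono e) (c d : K) :
    readVal v e he c = readVal v e he d ↔ v c = v d :=
  (WithTop.map_injective he.injective).eq_iff

theorem hasRadii (he : StrictMono e) (ha : IsPseudoCauchy v a) :
    HasRadii (readVal v e he) (fun i : Star I => a i)
      (fun i => (v (a (Order.succ (i : I)) - a i)).map e) := by
  -- Beyond `succ i` the distances are strictly smaller, so every later term is as far from `a i` as
  -- its successor is.
  have hdiff : ∀ (i : Star I) (j : I), (i : I) < j →
      v (a i - a j) = v (a (Order.succ (i : I)) - a i) := by
    intro i j hij
    rw [v.map_sub_swap (a (Order.succ (i : I)))]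
    rcases (Order.succ_le_of_lt hij).eq_or_lt with h | h
    · rw [h]
    · have h1 := ha i _ j (Order.lt_succ_of_not_isMax i.2) h
      have h2 := v.map_add_eq_of_lt_left h1
      rwa [sub_add_sub_cancel] at h2
  constructor
  · intro i j hij
    rw [readVal_apply, hdiff i j hij]
  · intro i j hij
    refine he.withTop_map ?_
    have h1 := ha i j (Order.succ (j : I)) hij (Order.lt_succ_of_not_isMax j.2)
    rwa [hdiff i j hij, v.map_sub_swap (a (j : I))] at h1

theorem seqVal_eq (he : StrictMono e) (i : Star I) :
    seqVal v e a i =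
      gaussVal (readVal v e he) (a i) ((v (a (Order.succ (i : I)) - a i)).map e) := rfl

theorem isIncreasing_seqVal [Nonempty (Star I)] [NoMaxOrder (Star I)] (he : StrictMono e)
    (ha : IsPseudoCauchy v a) : IsIncreasing v e (seqVal v e a) := by
  have hr := hasRadii he ha
  refine ⟨fun i => ⟨gaussVal (readVal v e he) (a i) _, fun f => rfl⟩, fun i c => gaussVal_C (readVal v e he) _ c _,
    fun i f hf => ?_, fun i j hij f => hr.gaussVal_mono hij f,
    fun f hf => hr.strictMono_of_not_isStable hf⟩
  have hne : seqVal v e a i f ≠ ⊤ := by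
    rw [seqVal_eq he]
    exact (gaussVal_eq_top_iff _ _ (hr.ne_top i) f).not.2 hf
  obtain ⟨n, hn⟩ := exists_gaussVal_eq_term (readVal v e he) (a i)
    ((v (a (Order.succ (i : I)) - a i)).map e) f
  rw [← seqVal_eq he] at hn
  have hγ := hr.ne_top i
  rw [hn] at hne ⊢
  rw [gaussTerm] at hne ⊢
  have h1 := (WithTop.add_ne_top.1 hne).1
  rw [readVal_apply] at h1 ⊢
  obtain ⟨g, hg⟩ := WithTop.ne_top_iff_exists.1 (WithTop.map_eq_top_iff.not.1 h1)
  obtain ⟨g', hg'⟩ := WithTop.ne_top_iff_exists.1 (WithTop.map_eq_top_iff.not.1 hγ)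
  rw [← hg, ← hg', WithTop.map_coe, WithTop.map_coe]
  refine ⟨g + n • g', ?_⟩
  rw [map_add, map_nsmul]
  rfl

theorem isFixed_iff_isStable [Nonempty (Star I)] [NoMaxOrder (Star I)] (he : StrictMono e)
    (ha : IsPseudoCauchy v a) (f : K[X]) : IsFixed v a f ↔ IsStable (seqVal v e a) f := by
  rw [IsFixed]
  simp only [← readVal_eq_readVal_iff he]
  exact (hasRadii he ha).eval_fixed_iff_isStable f

theorem IsMinNotFixed.isMinUnstable [Nonempty (Star I)] [NoMaxOrder (Star I)] (he : StrictMono e)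
    (ha : IsPseudoCauchy v a) {F : K[X]} (hF : IsMinNotFixed v a F) :
    IsMinUnstable (seqVal v e a) F := by
  obtain ⟨h1, h2, h3⟩ := hF
  simp only [isFixed_iff_isStable he ha] at h2 h3
  exact ⟨h1, h2, h3⟩

theorem exists_inCut {J : Type*} [LinearOrder J] [Nonempty J] [NoMaxOrder J]
    {ι : Γ →+o Hahn (FiniteArchimedeanClass Γ)}
    {ν : J → K[X] → WithTop (Hahn (ExtIndex (FiniteArchimedeanClass Γ)))}
    (hν : IsIncreasing v (bigEmb ι) ν) {F : K[X]} (hF : IsMinUnstable ν F) :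
    ∃ γ ∈ smallExt (FiniteArchimedeanClass Γ), InCut (bigEmb ι) ν F γ := by
  have hsep : ∀ l ∈ (cutOf (divClosure (bigEmb ι)) ν F).1,
      ∀ u ∈ (cutOf (divClosure (bigEmb ι)) ν F).2, l < u := by
    rintro l ⟨-, i, hi⟩ u ⟨-, hu⟩
    by_contra! hle
    exact hu ⟨i, (WithTop.coe_le_coe.2 hle).trans hi⟩
  obtain ⟨γ, hγ, h1, h2⟩ := exists_cut_realization ι (fun x hx => hx.1) (fun x hx => hx.1) hsep
  obtain ⟨y, hy, -⟩ := hν.exists_values hF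
  refine ⟨γ, hγ, fun i => ?_, fun x hx hlt => h2 x ⟨hx, ?_⟩⟩
  · rw [hy, WithTop.coe_lt_coe]
    exact h1 _ ⟨map_mem_divClosure _ _, i, (hy i).ge⟩
  · rintro ⟨i, hi⟩
    exact absurd (hlt i) (not_lt.2 hi)

end SequenceFamily

end PseudoCauchy

theorem mainTheorem9 {K Γ I : Type*} [Field K]
    [AddCommGroup Γ] [LinearOrder Γ] [IsOrderedAddMonoid Γ]
    (v : AddValuation K (WithTop Γ)) (hv : ∀ g : Γ, ∃ c : K, v c = (g : WithTop Γ))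
    (ι : Γ →+o PseudoCauchy.Hahn (FiniteArchimedeanClass Γ)) (hι : StrictMono ι)
    [LinearOrder I] [WellFoundedLT I] [Nontrivial I] [SuccOrder I]
    (a : I → K) (ha : PseudoCauchy.IsPseudoCauchy v a)
    (halg : PseudoCauchy.IsAlgebraicType v a)
    (F : K[X]) (hF : PseudoCauchy.IsMinNotFixed v a F) :
    let Λ := PseudoCauchy.Hahn (PseudoCauchy.ExtIndex (FiniteArchimedeanClass Γ))
    let e : Γ →+ Λ := PseudoCauchy.bigEmb ι
    -- the set of admissible values, the valuations with these values, and the divisible closure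
    let R : Set Λ := PseudoCauchy.smallExt (FiniteArchimedeanClass Γ)
    let V : Set (K[X] → WithTop Λ) := PseudoCauchy.extVals v e R
    let ΓQ : Set Λ := PseudoCauchy.divClosure e
    let ν : PseudoCauchy.Star I → K[X] → WithTop Λ := PseudoCauchy.seqVal v e a
    let μ : K[X] → WithTop Λ → K[X] → WithTop Λ := PseudoCauchy.limitVal v e a
    let δ : Set Λ × Set Λ := PseudoCauchy.cutOf ΓQ ν F
    -- the cut `δ` has a supremum `γ`
    (∃ γ ∈ R, PseudoCauchy.quasiCut ΓQ γ = δ) ∧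
    -- the cut does not depend on the choice of `F`
    (∀ G : K[X], PseudoCauchy.IsMinNotFixed v a G → PseudoCauchy.cutOf ΓQ ν G = δ) ∧
    (∀ γ ∈ R, PseudoCauchy.quasiCut ΓQ γ = δ →
      (∀ α : WithTop Λ, (α = ⊤ ∨ ∃ x ∈ R, α = (x : WithTop Λ)) → (γ : WithTop Λ) ≤ α →
        μ F α ∈ V) ∧
      PseudoCauchy.IsSup V ν (μ F γ) ∧
      (∀ μ' : K[X] → WithTop Λ, PseudoCauchy.IsSup V ν μ' →
        PseudoCauchy.Equivalent μ' (μ F γ)) ∧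
      ∀ G : K[X], PseudoCauchy.IsMinNotFixed v a G → μ G γ = μ F γ) ∧
    -- if the values of `F` are cofinal in `ΓQ`, the same for `∞` in place of `γ`, with respect to
    -- the valuations that have no finite value above `ΓQ`
    (δ.1 = ΓQ →
      IsLeast {μ' ∈ V | (∀ f, (∀ g ∈ ΓQ, ((g : Λ) : WithTop Λ) ≤ μ' f) → μ' f = ⊤) ∧
        ∀ i, ν i ≤ μ'} (μ F ⊤) ∧
      ∀ G : K[X], PseudoCauchy.IsMinNotFixed v a G → μ G ⊤ = μ F ⊤) := by
  intro Λ e R V ΓQ ν μ δ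
  have he : StrictMono e := PseudoCauchy.bigEmb_strictMono hι
  have : NoMaxOrder (PseudoCauchy.Star I) := ⟨halg.1⟩
  have : Nonempty (PseudoCauchy.Star I) := by
    obtain ⟨i, j, hij⟩ := exists_pair_lt I
    exact ⟨⟨i, not_isMax_of_lt hij⟩⟩
  have hν : PseudoCauchy.IsIncreasing v e ν := PseudoCauchy.isIncreasing_seqVal he ha
  have hmin : ∀ G, PseudoCauchy.IsMinNotFixed v a G → PseudoCauchy.IsMinUnstable ν G :=
    fun G hG => hG.isMinUnstable he ha
  have hF' := hmin F hF
  have hdiv : ∀ n : ℕ, n ≠ 0 → ∀ x : Λ, ∃ z, n • z = x := PseudoCauchy.exists_nsmul_eq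
  have hR : ∀ x ∈ R, ∀ (g : Γ) (n : ℕ), e g + n • x ∈ R := fun x hx g n =>
    PseudoCauchy.bigEmb_add_nsmul_mem ι hx g n
  obtain ⟨γ₀, hγ₀R, hγ₀⟩ := PseudoCauchy.exists_inCut hν hF'
  refine ⟨⟨γ₀, hγ₀R, PseudoCauchy.IsIncreasing.quasiCut_eq_of_inCut hγ₀⟩,
    fun G hG => hν.cutOf_eq_of_min hF' (hmin G hG) ΓQ, fun γ hγR hγδ => ?_, fun hcof => ?_⟩
  · have hγ := hν.inCut_of_quasiCut_eq hF' hγδ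
    exact ⟨fun α hα hle => hν.augment_mem hdiv hF' hγ hR hγR hα hle,
      hν.isSup_augment hdiv he.injective hF' hγ hR hγR,
      fun μ' hμ' => hν.equivalent_of_isSup hdiv he.injective hv hF' hγ hR hγR hμ',
      fun G hG => hν.augment_eq_of_min hdiv hF' (hmin G hG) hγ⟩
  -- Even here a `γ₀` in the cut is needed: it lies above `ΓQ`, and `γ₀ ≤ ⊤` is what makes the
  -- augmentation at `⊤` a valuation.
  · refine ⟨hν.isLeast_augment_top hdiv hF' hγ₀ hR hγ₀R hcof, fun G hG => ?_⟩
    rw [hν.eq_of_cofinal hF' (hmin G hG) hcof]
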